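/- Let $X$ be a complex manifold of dimension $d$, let $D\subset X$ be a reduced divisor with local normal crossings (near every point of $X$ there are holomorphic coordinates $x_1,\dots,x_d$ in which $D$ is defined by $x_1\cdots x_k=0$ for some $0\le k\le d$), and let $i_U:U=X\setminus D\to X$ be the inclusion. Let $\Omega_X^\bullet(\log D)$ be the complex of logarithmic forms, i.e. of the forms $\beta$, holomorphic on $U$, such that $\beta$ and $d\beta$ have at most simple poles along $D$. The log-minus (or minor log) complex $\Omega_X^\bullet(\log D)(-D)$ is the subcomplex of the holomorphic de Rham complex $\Omega_X^\bullet$ consisting of the forms that are locally $F\beta$, where $F$ is a reduced local equation of $D$ and $\beta$ is a logarithmic form; its differential is the exterior derivative. Let $\mathbb C_{U!}=i_{U!}(\mathbb C_U)$ be the extension by zero of the constant sheaf on $U$: its sections over an open set $V$ are the locally constant functions on $U\cap V$ whose support is closed in $V$. Then $\Omega_X^\bullet(\log D)(-D)$ is a resolution of $\mathbb C_{U!}$: the natural inclusion $\mathbb C_{U!}\to\Omega_X^0(\log D)(-D)=\mathcal O_X(-D)$ (extend a locally constant function by $0$) induces a quasi-isomorphism of complexes of sheaves of complex vector spaces on $X$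 from $\mathbb C_{U!}$, placed in degree $0$, to $\Omega_X^\bullet(\log D)(-D)$. -/

import Mathlib

open CategoryTheory TopologicalSpace Opposite Filter Topology
open scoped Manifold ContDiff

universe u

noncomputable section

/-- The forgetful functor of complex vector spaces preserves filtered colimits, in any universe. It
makes the category of sheaves of complex vector spaces on a space abelian. -/
instance forget_moduleCat_preservesFilteredColimits :
    Limits.PreservesFilteredColimits (forget (ModuleCat.{u} ℂ)) where
  preserves_filtered_colimits J _ _ := by
    have h : Limits.PreservesColimitsOfShape J
      (forget₂ (ModuleCat.{u} ℂ) AddCommGrpCat.{u} ⋙ forget AddCommGrpCat.{u}) := inferInstance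
    exact h

section GermSheaves

variable {X : Type u} [TopologicalSpace X]

/-- Extension by the junk value `0` of a family defined on an open set `V`. Only its germs at points
of `V` are ever used. -/
def extendSection {T : X → Type} [∀ x, AddCommGroup (T x)] [∀ x, Module ℂ (T x)] (V : Opens X) :
    (∀ x : V, T x) →ₗ[ℂ] ∀ x, T x where
  toFun s := by
    classical
    exact fun y => if h : y ∈ V then s ⟨y, h⟩ else 0
  map_add' s t := by
    funext y
    by_cases h : y ∈ V <;> simp [h]
  map_smul' c s := by
    funext y
    by_cases h : y ∈ V <;> simp [h]

/-- A local condition on families `s` in `∏ x, T x`: for each point `x` a linear condition on `s`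
that depends only on the germ of `s` at `x`. -/
structure GermCondition (T : X → Type) [∀ x, AddCommGroup (T x)] [∀ x, Module ℂ (T x)] where
  holds : X → Submodule ℂ (∀ x, T x)
  congr : ∀ {x : X} {s t : ∀ x, T x}, s ∈ holds x → (∀ᶠ y in 𝓝 x, s y = t y) → t ∈ holds x

namespace GermCondition

variable {T T' : X → Type} [∀ x, AddCommGroup (T x)] [∀ x, Module ℂ (T x)]
  [∀ x, AddCommGroup (T' x)] [∀ x, Module ℂ (T' x)]

theorem extendSection_apply (V : Opens X) (s : ∀ x : V, T x) (x : V) :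
    extendSection V s x = s x := by
  simp [extendSection]

theorem eventually_extendSection_res {V W : Opens X} (h : W ≤ V) (s : ∀ x : V, T x) (x : W) :
    ∀ᶠ y in 𝓝 (x : X), extendSection V s y = extendSection W (fun z => s ⟨z, h z.2⟩) y := by
  filter_upwards [W.isOpen.mem_nhds x.2] with y hy
  have hy : y ∈ W := hy
  simp [extendSection, hy, h hy]

/-- The families over `V` that satisfy the condition at every point of `V`. -/
def sections (A : GermCondition T) (V : Opens X) : Submodule ℂ (∀ x : V, T x) where
  carrier := {s | ∀ x : V, extendSection V s ∈ A.holds x}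
  add_mem' hs ht x := by
    rw [map_add]
    exact (A.holds x).add_mem (hs x) (ht x)
  zero_mem' x := by
    rw [map_zero]
    exact (A.holds x).zero_mem
  smul_mem' c s hs x := by
    rw [map_smul]
    exact (A.holds x).smul_mem c (hs x)

/-- Restriction of families. -/
def res (A : GermCondition T) {V W : Opens X} (h : W ≤ V) : A.sections V →ₗ[ℂ] A.sections W where
  toFun s := ⟨fun x => s.1 ⟨x, h x.2⟩, fun x =>
    A.congr (s.2 ⟨x, h x.2⟩) (eventually_extendSection_res h s.1 x)⟩
  map_add' _ _ := rfl
  map_smul' _ _ := rfl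

/-- The presheaf of families that satisfy the condition. -/
def presheaf (A : GermCondition T) : TopCat.Presheaf (ModuleCat.{u} ℂ) (TopCat.of X) where
  obj V := ModuleCat.of ℂ (A.sections V.unop)
  map i := ModuleCat.ofHom (A.res i.unop.le)

/-- The local predicate. -/
def localPredicate (A : GermCondition T) : TopCat.LocalPredicate (X := TopCat.of X) T where
  pred {V} s := s ∈ A.sections V
  res {W V} i s hs := (A.res i.le ⟨s, hs⟩).2
  locality {V} s hs x := by
    obtain ⟨W, hxW, i, hW⟩ := hs x
    exact A.congr (hW ⟨x, hxW⟩)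
      ((eventually_extendSection_res i.le s ⟨x, hxW⟩).mono fun _ h => h.symm)

theorem presheaf_isSheaf (A : GermCondition T) : A.presheaf.IsSheaf := by
  rw [TopCat.Presheaf.isSheaf_iff_isSheaf_comp (forget (ModuleCat.{u} ℂ))]
  exact TopCat.subpresheafToTypes.isSheaf A.localPredicate

/-- The sheaf of families that satisfy the condition. -/
def sheaf (A : GermCondition T) : TopCat.Sheaf (ModuleCat.{u} ℂ) (TopCat.of X) :=
  ⟨A.presheaf, A.presheaf_isSheaf⟩

/-- A morphism of sheaves given by an operator `L` on families which is local, and additive and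
homogeneous on the families that satisfy the condition. -/
structure LocalOperator (A : GermCondition T) (B : GermCondition T') where
  op : (∀ x, T x) → ∀ x, T' x
  congr : ∀ {x : X} {s t : ∀ x, T x}, (∀ᶠ y in 𝓝 x, s y = t y) → op s x = op t x
  add : ∀ {x : X} {s t : ∀ x, T x}, s ∈ A.holds x → t ∈ A.holds x →
    op (s + t) x = op s x + op t x
  smul : ∀ {x : X} (c : ℂ) {s : ∀ x, T x}, s ∈ A.holds x → op (c • s) x = c • op s x
  maps : ∀ {x : X} {s : ∀ x, T x}, (∀ᶠ y in 𝓝 x, s ∈ A.holds y) → op s ∈ B.holds x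

namespace LocalOperator

variable {A : GermCondition T} {B : GermCondition T'}

/-- The operator on sections over `V`. -/
def onSections (L : LocalOperator A B) (V : Opens X) : A.sections V →ₗ[ℂ] B.sections V where
  toFun s := ⟨fun x => L.op (extendSection V s.1) x, fun x => by
    refine B.congr (L.maps (x := x) (s := extendSection V s.1) ?_) ?_
    · filter_upwards [V.isOpen.mem_nhds x.2] with y hy using s.2 ⟨y, hy⟩
    · filter_upwards [V.isOpen.mem_nhds x.2] with y hy
      exact (extendSection_apply V (fun x : V => L.op (extendSection V s.1) x) ⟨y, hy⟩).symm⟩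
  map_add' s t := by
    ext x
    change L.op (extendSection V (s.1 + t.1)) x = _
    rw [map_add]
    exact L.add (s.2 x) (t.2 x)
  map_smul' c s := by
    ext x
    change L.op (extendSection V (c • s.1)) x = _
    rw [map_smul]
    exact L.smul c (s.2 x)

/-- The morphism of sheaves. -/
def hom (L : LocalOperator A B) : A.sheaf ⟶ B.sheaf :=
  ⟨{ app := fun V => ModuleCat.ofHom (L.onSections V.unop)
     naturality := fun V W i => by
      ext s
      apply Subtype.ext
      funext x
      exact L.congr ((eventually_extendSection_res i.unop.le s.1 x).mono fun _ h => h.symm) }⟩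

theorem hom_comp_eq_zero {T'' : X → Type} [∀ x, AddCommGroup (T'' x)] [∀ x, Module ℂ (T'' x)]
    {C : GermCondition T''} (L : LocalOperator A B) (M : LocalOperator B C)
    (h : ∀ {s : ∀ x, T x} {x : X}, (∀ᶠ y in 𝓝 x, s ∈ A.holds y) → M.op (L.op s) x = 0) :
    L.hom ≫ M.hom = 0 := by
  apply CategoryTheory.Sheaf.hom_ext
  ext V s
  apply Subtype.ext
  funext x
  have hs : ∀ᶠ y in 𝓝 (x : X), extendSection V.unop s.1 ∈ A.holds y := by
    filter_upwards [V.unop.isOpen.mem_nhds x.2] with y hy using s.2 ⟨y, hy⟩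
  refine Eq.trans (M.congr ?_) (h hs)
  filter_upwards [V.unop.isOpen.mem_nhds x.2] with y hy
  exact extendSection_apply V.unop (fun x : V.unop => L.op (extendSection V.unop s.1) x) ⟨y, hy⟩

end LocalOperator

end GermCondition

end GermSheaves

section Analytic

variable {E : Type*} [NormedAddCommGroup E] [NormedSpace ℂ E]
variable {E' : Type*} [NormedAddCommGroup E'] [NormedSpace ℂ E']

theorem analyticAt_extDeriv {p : ℕ} {α : E → E [⋀^Fin p]→L[ℂ] ℂ} {x : E}
    (hα : AnalyticAt ℂ α x) : AnalyticAt ℂ (extDeriv α) x := by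
  let T := ContinuousAlternatingMap.alternatizeUncurryFinCLM ℂ E ℂ (n := p)
  have h : AnalyticAt ℂ (T ∘ fderiv ℂ α) x := (T.analyticAt _).comp hα.fderiv
  exact h

variable [FiniteDimensional ℂ E]

theorem analyticAt_form_iff {p : ℕ} {f : E' → E [⋀^Fin p]→L[ℂ] ℂ} {x : E'} :
    AnalyticAt ℂ f x ↔ ∀ v : Fin p → E, AnalyticAt ℂ (fun y => f y v) x := by
  constructor
  · intro h v
    exact ((ContinuousAlternatingMap.apply ℂ E ℂ v).analyticAt _).comp h
  · intro h
    let b := Module.finBasis ℂ E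
    let ev : (E [⋀^Fin p]→L[ℂ] ℂ) →ₗ[ℂ] ((Fin p → Fin (Module.finrank ℂ E)) → ℂ) :=
      { toFun := fun g s => g (fun i => b (s i))
        map_add' := fun _ _ => rfl
        map_smul' := fun _ _ => rfl }
    have hev : LinearMap.ker ev = ⊥ := by
      rw [LinearMap.ker_eq_bot]
      intro g g' hgg
      have : g.toAlternatingMap = g'.toAlternatingMap := by
        refine Module.Basis.ext_alternating b fun s _ => ?_
        exact congrFun hgg s
      ext v
      exact congrArg (fun k : E [⋀^Fin p]→ₗ[ℂ] ℂ => k v) this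
    obtain ⟨g, hg⟩ := ev.exists_leftInverse_of_injective hev
    have h1 : AnalyticAt ℂ (fun y => ev (f y)) x := by
      rw [analyticAt_pi_iff]
      intro s
      exact h _
    have h2 := ((LinearMap.toContinuousLinearMap g).analyticAt (ev (f x))).comp
      (f := fun y => ev (f y)) h1
    convert h2 using 1
    funext y
    exact (LinearMap.congr_fun hg (f y)).symm

theorem analyticAt_form_comp {p : ℕ} {α : E' → E [⋀^Fin p]→L[ℂ] ℂ} {L : E' → E →L[ℂ] E} {x : E'}
    (hα : AnalyticAt ℂ α x) (hL : AnalyticAt ℂ L x) :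
    AnalyticAt ℂ (fun y => (α y).compContinuousLinearMap (L y)) x := by
  rw [analyticAt_form_iff]
  intro v
  have h1 : AnalyticAt ℂ (fun y => ContinuousMultilinearMap.compContinuousLinearMapContinuousMultilinear
      ℂ (fun _ : Fin p => E) (fun _ : Fin p => E) ℂ (fun _ => L y)) x := by
    refine (ContinuousMultilinearMap.analyticAt _).comp (f := fun y => fun _ : Fin p => L y) ?_
    rw [analyticAt_pi_iff]
    exact fun _ => hL
  have h2 : AnalyticAt ℂ (fun y => (α y).toContinuousMultilinearMap) x :=
    ((ContinuousAlternatingMap.toContinuousMultilinearMapCLM ℂ (E := E) (F := ℂ)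
      (ι := Fin p) (𝕜 := ℂ)).analyticAt _).comp hα
  have h3 := ((h1.contDiffAt (n := ω)).clm_apply (h2.contDiffAt (n := ω))).analyticAt
  exact ((ContinuousMultilinearMap.apply ℂ (fun _ : Fin p => E) ℂ v).analyticAt _).comp h3

end Analytic

section Forms

variable {d : ℕ} {X : Type u} [TopologicalSpace X] [ChartedSpace (Fin d → ℂ) X]

/-- The fibre at `x` of the bundle of holomorphic `p`-forms: the alternating `ℂ`-multilinear
`p`-forms on the holomorphic tangent space at `x`. -/
abbrev FormFiber (d p : ℕ) {X : Type u} [TopologicalSpace X] [ChartedSpace (Fin d → ℂ) X]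
    (x : X) : Type :=
  TangentSpace 𝓘(ℂ, Fin d → ℂ) x [⋀^Fin p]→L[ℂ] ℂ

/-- The expression of a form `α` in a chart `e`, that is the pull-back of `α` by `e.symm`. -/
def chartForm {p : ℕ} (e : OpenPartialHomeomorph X (Fin d → ℂ)) (α : ∀ x : X, FormFiber d p x)
    (y : Fin d → ℂ) : (Fin d → ℂ) [⋀^Fin p]→L[ℂ] ℂ :=
  (α (e.symm y)).compContinuousLinearMap
    (mfderiv 𝓘(ℂ, Fin d → ℂ) 𝓘(ℂ, Fin d → ℂ) e.symm y)

/-- The form `α` is holomorphic at `x` (hence near `x`). -/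
def HolomorphicFormAt {p : ℕ} (α : ∀ x : X, FormFiber d p x) (x : X) : Prop :=
  AnalyticAt ℂ (chartForm (chartAt (Fin d → ℂ) x) α) (chartAt (Fin d → ℂ) x x)

/-- The exterior derivative on a complex manifold, computed at `x` in the preferred chart. -/
def manifoldExtDeriv {p : ℕ} (α : ∀ x : X, FormFiber d p x) (x : X) : FormFiber d (p + 1) x :=
  (extDeriv (chartForm (chartAt (Fin d → ℂ) x) α)
    (chartAt (Fin d → ℂ) x x)).compContinuousLinearMap
    (mfderiv 𝓘(ℂ, Fin d → ℂ) 𝓘(ℂ, Fin d → ℂ) (chartAt (Fin d → ℂ) x) x)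

variable {p : ℕ} {e e' : OpenPartialHomeomorph X (Fin d → ℂ)} {α β : ∀ x : X, FormFiber d p x}

theorem chartForm_congr {x : X} (hx : x ∈ e.source) (h : ∀ᶠ y in 𝓝 x, α y = β y) :
    chartForm e α =ᶠ[𝓝 (e x)] chartForm e β := by
  have hc : ContinuousAt e.symm (e x) := e.continuousAt_symm (e.map_source hx)
  rw [ContinuousAt, e.left_inv hx] at hc
  filter_upwards [hc.eventually h] with y hy
  rw [chartForm, chartForm, hy]

theorem HolomorphicFormAt.congr {x : X} (hα : HolomorphicFormAt α x)
    (h : ∀ᶠ y in 𝓝 x, α y = β y) : HolomorphicFormAt β x :=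
  AnalyticAt.congr hα (chartForm_congr (mem_chart_source _ x) h)

theorem manifoldExtDeriv_congr {x : X} (h : ∀ᶠ y in 𝓝 x, α y = β y) :
    manifoldExtDeriv α x = manifoldExtDeriv β x := by
  rw [manifoldExtDeriv, manifoldExtDeriv,
    (chartForm_congr (mem_chart_source _ x) h).extDeriv_eq]

theorem chartForm_add : chartForm e (α + β) = chartForm e α + chartForm e β := rfl

theorem chartForm_smul (f : X → ℂ) :
    chartForm e (fun x => f x • α x) = fun y => f (e.symm y) • chartForm e α y := rfl

section

local notation "𝓐" => IsManifold.maximalAtlas 𝓘(ℂ, Fin d → ℂ) ω X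

theorem mdiff_chart (he : e ∈ 𝓐) {x : X} (hx : x ∈ e.source) :
    MDifferentiableAt 𝓘(ℂ, Fin d → ℂ) 𝓘(ℂ, Fin d → ℂ) e x :=
  (contMDiffAt_of_mem_maximalAtlas he hx).mdifferentiableAt (by simp)

theorem mdiff_chart_symm (he : e ∈ 𝓐) {y : Fin d → ℂ} (hy : y ∈ e.target) :
    MDifferentiableAt 𝓘(ℂ, Fin d → ℂ) 𝓘(ℂ, Fin d → ℂ) e.symm y :=
  (contMDiffAt_symm_of_mem_maximalAtlas he hy).mdifferentiableAt (by simp)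

theorem analyticAt_transition (he : e ∈ 𝓐) (he' : e' ∈ 𝓐) {y : Fin d → ℂ} (hy : y ∈ e.target)
    (hy' : e.symm y ∈ e'.source) : AnalyticAt ℂ (fun z => e' (e.symm z)) y := by
  refine ContDiffAt.analyticAt (contMDiffAt_iff_contDiffAt.1 ?_)
  exact (contMDiffAt_of_mem_maximalAtlas he' hy').comp y
    (contMDiffAt_symm_of_mem_maximalAtlas he hy)

theorem chartForm_transition (he : e ∈ 𝓐) (he' : e' ∈ 𝓐) (α : ∀ x : X, FormFiber d p x)
    {y : Fin d → ℂ} (hy : y ∈ e.target) (hy' : e.symm y ∈ e'.source) :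
    chartForm e α y = (chartForm e' α (e' (e.symm y))).compContinuousLinearMap
      (fderiv ℂ (fun z => e' (e.symm z)) y) := by
  have hφ : MDifferentiableAt 𝓘(ℂ, Fin d → ℂ) 𝓘(ℂ, Fin d → ℂ) (fun z => e' (e.symm z)) y :=
    (analyticAt_transition he he' hy hy').differentiableAt.mdifferentiableAt
  have h1 : ∀ᶠ z in 𝓝 y, e.symm z = e'.symm (e' (e.symm z)) := by
    filter_upwards [(e.continuousAt_symm hy).preimage_mem_nhds (e'.open_source.mem_nhds hy')]
      with z hz
    exact (e'.left_inv hz).symm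
  have h2 : (mfderiv 𝓘(ℂ, Fin d → ℂ) 𝓘(ℂ, Fin d → ℂ) e.symm y : (Fin d → ℂ) →L[ℂ] (Fin d → ℂ)) =
      (mfderiv 𝓘(ℂ, Fin d → ℂ) 𝓘(ℂ, Fin d → ℂ) e'.symm (e' (e.symm y)) :
        (Fin d → ℂ) →L[ℂ] (Fin d → ℂ)).comp (fderiv ℂ (fun z => e' (e.symm z)) y) := by
    have h3 := mfderiv_comp y (mdiff_chart_symm he' (e'.map_source hy')) hφ
    rw [mfderiv_eq_fderiv (f := fun z => e' (e.symm z))] at h3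
    have h4 := Filter.EventuallyEq.mfderiv_eq (I := 𝓘(ℂ, Fin d → ℂ)) (I' := 𝓘(ℂ, Fin d → ℂ)) h1
    exact h4.trans h3
  have h5 : (α (e'.symm (e' (e.symm y))) : (Fin d → ℂ) [⋀^Fin p]→L[ℂ] ℂ) = α (e.symm y) := by
    rw [e'.left_inv hy']
  ext v
  change (α (e.symm y) : (Fin d → ℂ) [⋀^Fin p]→L[ℂ] ℂ) (fun i =>
    (mfderiv 𝓘(ℂ, Fin d → ℂ) 𝓘(ℂ, Fin d → ℂ) e.symm y : (Fin d → ℂ) →L[ℂ] (Fin d → ℂ)) (v i)) = _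
  rw [h2, ← h5]
  rfl

theorem chartForm_transition_eventually (he : e ∈ 𝓐) (he' : e' ∈ 𝓐) (α : ∀ x : X, FormFiber d p x)
    {y : Fin d → ℂ} (hy : y ∈ e.target) (hy' : e.symm y ∈ e'.source) :
    chartForm e α =ᶠ[𝓝 y] fun z => (chartForm e' α (e' (e.symm z))).compContinuousLinearMap
      (fderiv ℂ (fun z => e' (e.symm z)) z) := by
  filter_upwards [(e.continuousAt_symm hy).preimage_mem_nhds (e'.open_source.mem_nhds hy'),
    e.open_target.mem_nhds hy] with z hz hz'
  exact chartForm_transition he he' α hz' hz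

theorem analyticAt_chartForm_of (he : e ∈ 𝓐) (he' : e' ∈ 𝓐) {y : Fin d → ℂ} (hy : y ∈ e.target)
    (hy' : e.symm y ∈ e'.source) (h : AnalyticAt ℂ (chartForm e' α) (e' (e.symm y))) :
    AnalyticAt ℂ (chartForm e α) y := by
  refine AnalyticAt.congr ?_ (chartForm_transition_eventually he he' α hy hy').symm
  have hφ := analyticAt_transition he he' hy hy'
  exact analyticAt_form_comp (h.comp (f := fun z => e' (e.symm z)) hφ) hφ.fderiv

theorem chartForm_injective (he : e ∈ 𝓐) {x : X} (hx : x ∈ e.source)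
    (h : chartForm e α (e x) = chartForm e β (e x)) : α x = β x := by
  have hm : e.MDifferentiable 𝓘(ℂ, Fin d → ℂ) 𝓘(ℂ, Fin d → ℂ) :=
    ⟨fun y hy => (mdiff_chart he hy).mdifferentiableWithinAt,
      fun y hy => (mdiff_chart_symm he hy).mdifferentiableWithinAt⟩
  have key : ∀ α : ∀ x : X, FormFiber d p x, (chartForm e α (e x)).compContinuousLinearMap
      (mfderiv 𝓘(ℂ, Fin d → ℂ) 𝓘(ℂ, Fin d → ℂ) e x :
        (Fin d → ℂ) →L[ℂ] (Fin d → ℂ)) = α x := by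
    intro α
    have h1 : (α (e.symm (e x)) : (Fin d → ℂ) [⋀^Fin p]→L[ℂ] ℂ) = α x := by rw [e.left_inv hx]
    have h2 : (mfderiv 𝓘(ℂ, Fin d → ℂ) 𝓘(ℂ, Fin d → ℂ) e.symm (e x) :
        (Fin d → ℂ) →L[ℂ] (Fin d → ℂ)).comp (mfderiv 𝓘(ℂ, Fin d → ℂ) 𝓘(ℂ, Fin d → ℂ) e x :
        (Fin d → ℂ) →L[ℂ] (Fin d → ℂ)) = ContinuousLinearMap.id ℂ (Fin d → ℂ) :=
      hm.symm_comp_deriv hx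
    ext v
    change (α (e.symm (e x)) : (Fin d → ℂ) [⋀^Fin p]→L[ℂ] ℂ) (fun i =>
      ((mfderiv 𝓘(ℂ, Fin d → ℂ) 𝓘(ℂ, Fin d → ℂ) e.symm (e x) :
        (Fin d → ℂ) →L[ℂ] (Fin d → ℂ)).comp (mfderiv 𝓘(ℂ, Fin d → ℂ) 𝓘(ℂ, Fin d → ℂ) e x :
        (Fin d → ℂ) →L[ℂ] (Fin d → ℂ))) (v i)) = _
    rw [h2, h1]
    rfl
  rw [← key α, ← key β, h]

variable [IsManifold 𝓘(ℂ, Fin d → ℂ) ω X]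

/-- Holomorphy may be tested in any chart. -/
theorem holomorphicFormAt_iff (he : e ∈ 𝓐) {x : X} (hx : x ∈ e.source) :
    HolomorphicFormAt α x ↔ AnalyticAt ℂ (chartForm e α) (e x) := by
  have hc := IsManifold.chart_mem_maximalAtlas (I := 𝓘(ℂ, Fin d → ℂ)) (n := ω) x
  have hx' := mem_chart_source (Fin d → ℂ) x
  constructor
  · intro h
    refine analyticAt_chartForm_of he hc (e.map_source hx) ?_ ?_ <;> rw [e.left_inv hx]
    exacts [hx', h]
  · intro h
    refine analyticAt_chartForm_of hc he (OpenPartialHomeomorph.map_source _ hx') ?_ ?_ <;>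
      rw [OpenPartialHomeomorph.left_inv _ hx']
    exacts [hx, h]

theorem HolomorphicFormAt.eventually {x : X} (h : HolomorphicFormAt α x) :
    ∀ᶠ y in 𝓝 x, HolomorphicFormAt α y := by
  have hc := IsManifold.chart_mem_maximalAtlas (I := 𝓘(ℂ, Fin d → ℂ)) (n := ω) x
  have hx' := mem_chart_source (Fin d → ℂ) x
  filter_upwards [(chartAt (Fin d → ℂ) x).open_source.mem_nhds hx',
    ((chartAt (Fin d → ℂ) x).continuousAt hx').eventually h.eventually_analyticAt] with y hy hy'
  exact (holomorphicFormAt_iff hc hy).2 hy'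

/-- The exterior derivative may be computed in any chart. -/
theorem chartForm_manifoldExtDeriv (he : e ∈ 𝓐) {y : Fin d → ℂ} (hy : y ∈ e.target)
    (h : HolomorphicFormAt α (e.symm y)) :
    chartForm e (manifoldExtDeriv α) y = extDeriv (chartForm e α) y := by
  have hc := IsManifold.chart_mem_maximalAtlas (I := 𝓘(ℂ, Fin d → ℂ)) (n := ω) (e.symm y)
  have hx' := mem_chart_source (Fin d → ℂ) (e.symm y)
  have hφ := analyticAt_transition he hc hy hx'
  rw [(chartForm_transition_eventually he hc α hy hx').extDeriv_eq,
    extDeriv_pullback (r := ω) (f := fun z => (chartAt (Fin d → ℂ) (e.symm y)) (e.symm z))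
      (AnalyticAt.differentiableAt h) hφ.contDiffAt (by simp)]
  have h3 := mfderiv_comp y (mdiff_chart hc hx') (mdiff_chart_symm he hy)
  have h4 : (fderiv ℂ (fun z => (chartAt (Fin d → ℂ) (e.symm y)) (e.symm z)) y) = _ :=
    mfderiv_eq_fderiv.symm.trans h3
  rw [h4]
  rfl

theorem chartForm_manifoldExtDeriv_eventually (he : e ∈ 𝓐) {x : X} (hx : x ∈ e.source)
    (h : HolomorphicFormAt α x) :
    chartForm e (manifoldExtDeriv α) =ᶠ[𝓝 (e x)] extDeriv (chartForm e α) := by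
  have hc : ContinuousAt e.symm (e x) := e.continuousAt_symm (e.map_source hx)
  rw [ContinuousAt, e.left_inv hx] at hc
  filter_upwards [hc.eventually h.eventually, e.open_target.mem_nhds (e.map_source hx)] with y hy hy'
  exact chartForm_manifoldExtDeriv he hy' hy

theorem HolomorphicFormAt.extDeriv {x : X} (h : HolomorphicFormAt α x) :
    HolomorphicFormAt (manifoldExtDeriv α) x := by
  have hc := IsManifold.chart_mem_maximalAtlas (I := 𝓘(ℂ, Fin d → ℂ)) (n := ω) x
  exact (analyticAt_extDeriv h).congr
    (chartForm_manifoldExtDeriv_eventually hc (mem_chart_source _ x) h).symm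

theorem manifoldExtDeriv_manifoldExtDeriv {x : X} (h : HolomorphicFormAt α x) :
    manifoldExtDeriv (manifoldExtDeriv α) x = 0 := by
  have hc := IsManifold.chart_mem_maximalAtlas (I := 𝓘(ℂ, Fin d → ℂ)) (n := ω) x
  rw [manifoldExtDeriv, (chartForm_manifoldExtDeriv_eventually hc (mem_chart_source _ x)
    h).extDeriv_eq, extDeriv_extDeriv_apply (r := ω) (AnalyticAt.contDiffAt h) (by simp)]
  rfl

end

theorem HolomorphicFormAt.add {x : X} (h : HolomorphicFormAt α x) (h' : HolomorphicFormAt β x) :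
    HolomorphicFormAt (α + β) x := AnalyticAt.add h h'

theorem HolomorphicFormAt.const_smul {x : X} (c : ℂ) (h : HolomorphicFormAt α x) :
    HolomorphicFormAt (c • α) x :=
  AnalyticAt.fun_const_smul (c := c) (f := chartForm (chartAt (Fin d → ℂ) x) α) h

theorem manifoldExtDeriv_add {x : X} (h : HolomorphicFormAt α x) (h' : HolomorphicFormAt β x) :
    manifoldExtDeriv (α + β) x = manifoldExtDeriv α x + manifoldExtDeriv β x := by
  rw [manifoldExtDeriv, chartForm_add,
    extDeriv_add (AnalyticAt.differentiableAt h) (AnalyticAt.differentiableAt h')]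
  rfl

theorem manifoldExtDeriv_const_smul {x : X} (c : ℂ) :
    manifoldExtDeriv (c • α) x = c • manifoldExtDeriv α x := by
  have : chartForm (chartAt (Fin d → ℂ) x) (c • α) = c • chartForm (chartAt (Fin d → ℂ) x) α := rfl
  rw [manifoldExtDeriv, this, extDeriv_smul]
  rfl

end Forms

section MinorLog

/-- For a covector `l` and a form `b`, one has `l ∧ (l ∧ b) = 0`. -/
theorem alternatize_twice {E : Type*} [NormedAddCommGroup E] [NormedSpace ℂ E] {p : ℕ}
    (l : E →L[ℂ] ℂ) (b : E [⋀^Fin p]→L[ℂ] ℂ) :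
    ContinuousAlternatingMap.alternatizeUncurryFin
      (l.smulRight (ContinuousAlternatingMap.alternatizeUncurryFin (l.smulRight b))) = 0 := by
  have h := ContinuousAlternatingMap.alternatizeUncurryFin_alternatizeUncurryFinCLM_comp_of_symmetric
    (f := l.smulRight (l.smulRight b)) (by
      intro x y
      simp [smul_smul, mul_comm])
  rw [← h]
  congr 1
  ext1 x
  simp

/-- `d(g b) = g db + dg ∧ b`. -/
theorem extDeriv_fun_smul' {E : Type*} [NormedAddCommGroup E] [NormedSpace ℂ E] {p : ℕ}
    {g : E → ℂ} {b : E → E [⋀^Fin p]→L[ℂ] ℂ} {z : E} (hg : DifferentiableAt ℂ g z)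
    (hb : DifferentiableAt ℂ b z) :
    extDeriv (fun y => g y • b y) z = g z • extDeriv b z +
      ContinuousAlternatingMap.alternatizeUncurryFin ((fderiv ℂ g z).smulRight (b z)) := by
  rw [extDeriv, fderiv_fun_smul hg hb, ContinuousAlternatingMap.alternatizeUncurryFin_add,
    ContinuousAlternatingMap.alternatizeUncurryFin_smul]
  rfl

/-- `f d(f⁻¹ d(f b)) = -d(f db)`. -/
theorem extDeriv_twisted {E : Type*} [NormedAddCommGroup E] [NormedSpace ℂ E] {p : ℕ}
    {f : E → ℂ} {b : E → E [⋀^Fin p]→L[ℂ] ℂ} {z : E} (hf : AnalyticAt ℂ f z)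
    (hb : AnalyticAt ℂ b z) (hz : f z ≠ 0) :
    f z • extDeriv (fun y => (f y)⁻¹ • extDeriv (fun y => f y • b y) y) z =
      -extDeriv (fun y => f y • extDeriv b y) z := by
  have hd : ∀ {q : ℕ} {c : E → E [⋀^Fin q]→L[ℂ] ℂ}, AnalyticAt ℂ c z →
      AnalyticAt ℂ (extDeriv c) z := fun h => analyticAt_extDeriv h
  have hfb : AnalyticAt ℂ (fun y => f y • b y) z := hf.smul hb
  have hinv : HasFDerivAt (fun y => (f y)⁻¹) (-((f z) ^ 2)⁻¹ • fderiv ℂ f z) z :=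
    (hasDerivAt_inv hz).comp_hasFDerivAt z hf.differentiableAt.hasFDerivAt
  rw [extDeriv_fun_smul' hinv.differentiableAt (hd hfb).differentiableAt, hinv.fderiv,
    extDeriv_fun_smul' hf.differentiableAt (hd hb).differentiableAt,
    extDeriv_extDeriv_apply (r := ω) hfb.contDiffAt (by simp),
    extDeriv_extDeriv_apply (r := ω) hb.contDiffAt (by simp),
    extDeriv_fun_smul' hf.differentiableAt hb.differentiableAt]
  have h1 : ∀ (c : ℂ) (v w : E [⋀^Fin (p + 1)]→L[ℂ] ℂ), (c • fderiv ℂ f z).smulRight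
      (f z • v + w) = (c * f z) • (fderiv ℂ f z).smulRight v + c • (fderiv ℂ f z).smulRight w := by
    intro c v w
    ext1 x
    simp only [ContinuousLinearMap.smulRight_apply, smul_apply, smul_add,
      smul_smul, add_apply, smul_eq_mul]
    congr 2
    ring
  rw [h1, ContinuousAlternatingMap.alternatizeUncurryFin_add,
    ContinuousAlternatingMap.alternatizeUncurryFin_smul,
    ContinuousAlternatingMap.alternatizeUncurryFin_smul, alternatize_twice]
  simp only [smul_zero, zero_add, add_zero, smul_smul]
  have hc : f z * (-(f z ^ 2)⁻¹ * f z) = -1 := by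
    field_simp
  rw [hc, neg_one_smul]

variable {d : ℕ} {X : Type u} [TopologicalSpace X] [ChartedSpace (Fin d → ℂ) X]

/-- `e` is a holomorphic chart of `X` in whose domain `D` is the union of the coordinate
hyperplanes `xᵢ = 0`, `i ∈ J`. -/
structure IsAdaptedChart (D : Set X) (e : OpenPartialHomeomorph X (Fin d → ℂ))
    (J : Finset (Fin d)) : Prop where
  holomorphic : e ∈ IsManifold.maximalAtlas 𝓘(ℂ, Fin d → ℂ) ω X
  mem_iff : ∀ y ∈ e.source, y ∈ D ↔ ∃ i ∈ J, e y i = 0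

/-- `D` is (the support of) a reduced divisor with local normal crossings: near every point of `X`
there are holomorphic coordinates in which `D` is a union of coordinate hyperplanes. -/
def IsNormalCrossingDivisor (d : ℕ) {X : Type u} [TopologicalSpace X]
    [ChartedSpace (Fin d → ℂ) X] (D : Set X) : Prop :=
  ∀ x : X, ∃ (e : OpenPartialHomeomorph X (Fin d → ℂ)) (J : Finset (Fin d)),
    x ∈ e.source ∧ IsAdaptedChart D e J

/-- `F` is near `x` a reduced equation `∏_{i ∈ J} xᵢ` of `D`, for some adapted chart. -/
def IsLocalEquation (d : ℕ) {X : Type u} [TopologicalSpace X] [ChartedSpace (Fin d → ℂ) X]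
    (D : Set X) (F : X → ℂ) (x : X) : Prop :=
  ∃ (e : OpenPartialHomeomorph X (Fin d → ℂ)) (J : Finset (Fin d)),
    x ∈ e.source ∧ IsAdaptedChart D e J ∧ ∀ᶠ y in 𝓝 x, F y = ∏ i ∈ J, e y i

variable {p : ℕ}

/-- The germ at `x` of the form `β`, of which only the values off `D` matter, belongs to
`Ω^p(log D)`, where `F` is a local equation of `D` at `x`: `β` is holomorphic off `D`, and both
`β` and `dβ` have at most simple poles along `D`, that is, `F β` and `F dβ` extend
holomorphically across `D`. -/
structure IsLogFormAt (D : Set X) (F : X → ℂ) (β : ∀ x : X, FormFiber d p x) (x : X) : Prop where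
  holomorphic : ∀ᶠ y in 𝓝 x, y ∉ D → HolomorphicFormAt β y
  pole : ∃ γ : ∀ x : X, FormFiber d p x, HolomorphicFormAt γ x ∧
    ∀ᶠ y in 𝓝 x, y ∉ D → F y • β y = γ y
  pole_deriv : ∃ δ : ∀ x : X, FormFiber d (p + 1) x, HolomorphicFormAt δ x ∧
    ∀ᶠ y in 𝓝 x, y ∉ D → F y • manifoldExtDeriv β y = δ y

/-- The germ at `x` of `α` belongs to `Ω^p(log D)(-D) ⊆ Ω^p`: `α` is holomorphic and of the form
`F β`, where `F` is a local equation of `D` and `β` is a germ of `Ω^p(log D)`. (Local equations of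
`D` differ by units, so it does not matter which one is used.) -/
structure IsMinorLogFormAt (D : Set X) (α : ∀ x : X, FormFiber d p x) (x : X) : Prop where
  holomorphic : HolomorphicFormAt α x
  eq_smul : ∀ F : X → ℂ, IsLocalEquation d D F x →
    ∃ β : ∀ x : X, FormFiber d p x, IsLogFormAt D F β x ∧ ∀ᶠ y in 𝓝 x, y ∉ D → α y = F y • β y

theorem form_smul_zero (c : ℂ) (x : X) : c • (0 : FormFiber d p x) = 0 := by
  ext v
  simp

theorem holomorphicFormAt_zero (x : X) : HolomorphicFormAt (0 : ∀ x : X, FormFiber d p x) x :=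
  analyticAt_const (v := (0 : (Fin d → ℂ) [⋀^Fin p]→L[ℂ] ℂ))

theorem manifoldExtDeriv_zero (x : X) :
    manifoldExtDeriv (0 : ∀ x : X, FormFiber d p x) x = 0 := by
  have h : chartForm (chartAt (Fin d → ℂ) x) (0 : ∀ x : X, FormFiber d p x) = 0 := rfl
  rw [manifoldExtDeriv, h, extDeriv, fderiv_zero, Pi.zero_apply,
    ← ContinuousAlternatingMap.alternatizeUncurryFinCLM_apply, map_zero]
  rfl

section

variable {D : Set X} {F : X → ℂ} {α β : ∀ x : X, FormFiber d p x} {x : X}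

theorem IsLocalEquation.exists_chart (h : IsLocalEquation d D F x) :
    ∃ e : OpenPartialHomeomorph X (Fin d → ℂ),
      e ∈ IsManifold.maximalAtlas 𝓘(ℂ, Fin d → ℂ) ω X ∧ x ∈ e.source ∧
      ∀ᶠ y in 𝓝 x, y ∈ e.source ∧ AnalyticAt ℂ (fun z => F (e.symm z)) (e y) ∧
        (y ∉ D → F y ≠ 0) := by
  obtain ⟨e, J, hx, he, hF⟩ := h
  refine ⟨e, he.holomorphic, hx, ?_⟩
  filter_upwards [e.open_source.mem_nhds hx, hF.eventually_nhds] with y hy hFy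
  refine ⟨hy, ?_, ?_⟩
  · have h1 : AnalyticAt ℂ (fun z : Fin d → ℂ => ∏ i ∈ J, z i) (e y) :=
      Finset.analyticAt_fun_prod _ fun i _ =>
        (ContinuousLinearMap.proj (R := ℂ) (φ := fun _ : Fin d => ℂ) i).analyticAt _
    refine h1.congr ?_
    have hc : ContinuousAt e.symm (e y) := e.continuousAt_symm (e.map_source hy)
    rw [ContinuousAt, e.left_inv hy] at hc
    filter_upwards [hc.eventually hFy, e.open_target.mem_nhds (e.map_source hy)] with z hz hz'
    rw [hz, e.right_inv hz']
  · intro hyD h0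
    rw [hFy.self_of_nhds, Finset.prod_eq_zero_iff] at h0
    exact hyD ((he.mem_iff y hy).2 h0)

theorem IsLogFormAt.zero (D : Set X) (F : X → ℂ) (x : X) :
    IsLogFormAt D F (0 : ∀ x : X, FormFiber d p x) x where
  holomorphic := .of_forall fun y _ => holomorphicFormAt_zero y
  pole := ⟨0, holomorphicFormAt_zero x, .of_forall fun y _ => form_smul_zero _ _⟩
  pole_deriv := ⟨0, holomorphicFormAt_zero x, .of_forall fun y _ => by
    rw [manifoldExtDeriv_zero]
    exact form_smul_zero _ _⟩

theorem IsLogFormAt.add (h : IsLogFormAt D F α x) (h' : IsLogFormAt D F β x) :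
    IsLogFormAt D F (α + β) x := by
  obtain ⟨h1, ⟨γ, hγ, h2⟩, ⟨δ, hδ, h3⟩⟩ := h
  obtain ⟨h1', ⟨γ', hγ', h2'⟩, ⟨δ', hδ', h3'⟩⟩ := h'
  refine ⟨?_, ⟨γ + γ', hγ.add hγ', ?_⟩, ⟨δ + δ', hδ.add hδ', ?_⟩⟩
  · filter_upwards [h1, h1'] with y hy hy' hD using (hy hD).add (hy' hD)
  · filter_upwards [h2, h2'] with y hy hy' hD
    rw [Pi.add_apply, Pi.add_apply, smul_add, hy hD, hy' hD]
  · filter_upwards [h1, h1', h3, h3'] with y k k' hy hy' hD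
    rw [manifoldExtDeriv_add (k hD) (k' hD), Pi.add_apply, smul_add, hy hD, hy' hD]

theorem IsLogFormAt.smul (c : ℂ) (h : IsLogFormAt D F α x) : IsLogFormAt D F (c • α) x := by
  obtain ⟨h1, ⟨γ, hγ, h2⟩, ⟨δ, hδ, h3⟩⟩ := h
  refine ⟨?_, ⟨c • γ, hγ.const_smul c, ?_⟩, ⟨c • δ, hδ.const_smul c, ?_⟩⟩
  · filter_upwards [h1] with y hy hD using (hy hD).const_smul c
  · filter_upwards [h2] with y hy hD
    rw [Pi.smul_apply, Pi.smul_apply, smul_comm, hy hD]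
  · filter_upwards [h3] with y hy hD
    rw [manifoldExtDeriv_const_smul, Pi.smul_apply, smul_comm, hy hD]

variable [IsManifold 𝓘(ℂ, Fin d → ℂ) ω X]

theorem HolomorphicFormAt.fun_smul {e : OpenPartialHomeomorph X (Fin d → ℂ)}
    (he : e ∈ IsManifold.maximalAtlas 𝓘(ℂ, Fin d → ℂ) ω X) (hx : x ∈ e.source)
    (hF : AnalyticAt ℂ (fun z => F (e.symm z)) (e x)) (h : HolomorphicFormAt α x) :
    HolomorphicFormAt (fun y => F y • α y) x := by
  rw [holomorphicFormAt_iff he hx] at h ⊢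
  rw [chartForm_smul]
  exact hF.smul h

/-- The condition that defines `Ω^p(log D)(-D)`. -/
def minorLogCondition (d p : ℕ) {X : Type u} [TopologicalSpace X] [ChartedSpace (Fin d → ℂ) X]
    [IsManifold 𝓘(ℂ, Fin d → ℂ) ω X] (D : Set X) :
    GermCondition (X := X) (fun x => FormFiber d p x) where
  holds x :=
    { carrier := {α | IsMinorLogFormAt D α x}
      zero_mem' := ⟨holomorphicFormAt_zero x, fun F _ =>
        ⟨0, IsLogFormAt.zero D F x, .of_forall fun y _ => (form_smul_zero (F y) y).symm⟩⟩
      add_mem' := by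
        rintro α α' ⟨h, k⟩ ⟨h', k'⟩
        refine ⟨h.add h', fun F hF => ?_⟩
        obtain ⟨β, hβ, hαβ⟩ := k F hF
        obtain ⟨β', hβ', hαβ'⟩ := k' F hF
        refine ⟨β + β', hβ.add hβ', ?_⟩
        filter_upwards [hαβ, hαβ'] with y hy hy' hD
        rw [Pi.add_apply, Pi.add_apply, smul_add, hy hD, hy' hD]
      smul_mem' := by
        rintro c α ⟨h, k⟩
        refine ⟨h.const_smul c, fun F hF => ?_⟩
        obtain ⟨β, hβ, hαβ⟩ := k F hF
        refine ⟨c • β, hβ.smul c, ?_⟩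
        filter_upwards [hαβ] with y hy hD
        rw [Pi.smul_apply, Pi.smul_apply, smul_comm, hy hD] }
  congr := by
    rintro x α α' ⟨h, k⟩ hα
    refine ⟨h.congr hα, fun F hF => ?_⟩
    obtain ⟨β, hβ, hαβ⟩ := k F hF
    refine ⟨β, hβ, ?_⟩
    filter_upwards [hαβ, hα] with y hy hy' hD
    rw [← hy', hy hD]

theorem mem_minorLogCondition :
    α ∈ (minorLogCondition d p D).holds x ↔ IsMinorLogFormAt D α x := Iff.rfl

theorem IsMinorLogFormAt.extDeriv (h : IsMinorLogFormAt D α x) :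
    IsMinorLogFormAt D (manifoldExtDeriv α) x := by
  refine ⟨h.holomorphic.extDeriv, fun F hF => ?_⟩
  obtain ⟨β, ⟨h1, -, ⟨δ, hδ, h3⟩⟩, h4⟩ := h.eq_smul F hF
  obtain ⟨e, he, hx, hFe⟩ := hF.exists_chart
  have hα := h.holomorphic.eventually
  -- off `D`, the set of the good points is open near `x`
  have hDo : ∀ᶠ y in 𝓝 x, y ∉ D → ∀ᶠ z in 𝓝 y, z ∉ D := by
    obtain ⟨e', J, hx', he', -⟩ := hF
    filter_upwards [e'.open_source.mem_nhds hx'] with y hy hyD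
    have hne : ∀ i ∈ J, e' y i ≠ 0 := fun i hi h0 => hyD ((he'.mem_iff y hy).2 ⟨i, hi, h0⟩)
    have hne' : ∀ᶠ z in 𝓝 y, ∀ i ∈ J, e' z i ≠ 0 := by
      rw [Filter.eventually_all_finset]
      intro i hi
      exact ((continuous_apply i).continuousAt.comp (e'.continuousAt hy)).eventually_ne (hne i hi)
    filter_upwards [hne', e'.open_source.mem_nhds hy] with z hz hzs hzD
    obtain ⟨i, hi, h0⟩ := (he'.mem_iff z hzs).1 hzD
    exact hz i hi h0
  refine ⟨fun y => (F y)⁻¹ • manifoldExtDeriv α y, ⟨?_, ?_, ?_⟩, ?_⟩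
  · filter_upwards [hFe, hα] with y hy hαy hyD
    refine HolomorphicFormAt.fun_smul (F := fun y => (F y)⁻¹) he hy.1 (hy.2.1.inv ?_) hαy.extDeriv
    rw [e.left_inv hy.1]
    exact hy.2.2 hyD
  · refine ⟨manifoldExtDeriv α, h.holomorphic.extDeriv, ?_⟩
    filter_upwards [hFe] with y hy hyD
    rw [smul_smul, mul_inv_cancel₀ (hy.2.2 hyD), one_smul]
  · refine ⟨(-1 : ℂ) • manifoldExtDeriv δ, hδ.extDeriv.const_smul _, ?_⟩
    filter_upwards [hFe, hα, hDo, h1.eventually_nhds, h3.eventually_nhds, h4.eventually_nhds,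
      hδ.eventually] with y hy hαy hDy h1y h3y h4y hδy hyD
    -- compare the two sides in the chart `e`
    have hD' := hDy hyD
    have hβy : HolomorphicFormAt β y := h1y.self_of_nhds hyD
    have hyt := e.map_source hy.1
    have hF0 : F (e.symm (e y)) ≠ 0 := by
      rw [e.left_inv hy.1]
      exact hy.2.2 hyD
    have ea : chartForm e α =ᶠ[𝓝 (e y)] fun z => F (e.symm z) • chartForm e β z := by
      rw [← chartForm_smul]
      exact chartForm_congr hy.1 (by filter_upwards [hD', h4y] with z hz hz' using hz' hz)
    have eb := chartForm_manifoldExtDeriv_eventually he hy.1 hβy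
    have eδ : chartForm e δ =ᶠ[𝓝 (e y)]
        fun z => F (e.symm z) • _root_.extDeriv (chartForm e β) z := by
      have k : chartForm e (fun z => F z • manifoldExtDeriv β z) =ᶠ[𝓝 (e y)] chartForm e δ :=
        chartForm_congr hy.1 (by filter_upwards [hD', h3y] with z hz hz' using hz' hz)
      rw [chartForm_smul] at k
      filter_upwards [k, eb] with z hz hz'
      rw [← hz, hz']
    have eτ : chartForm e (fun y => (F y)⁻¹ • manifoldExtDeriv α y) =ᶠ[𝓝 (e y)]
        fun z => (F (e.symm z))⁻¹ •
          _root_.extDeriv (fun z => F (e.symm z) • chartForm e β z) z := by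
      rw [chartForm_smul (fun y => (F y)⁻¹)]
      filter_upwards [chartForm_manifoldExtDeriv_eventually he hy.1 hαy, ea.extDeriv] with z hz hz'
      rw [hz, hz']
    have hτ : HolomorphicFormAt (fun y => (F y)⁻¹ • manifoldExtDeriv α y) y :=
      HolomorphicFormAt.fun_smul (F := fun y => (F y)⁻¹) he hy.1 (hy.2.1.inv hF0) hαy.extDeriv
    have key : chartForm e (fun z => F z •
        manifoldExtDeriv (fun y => (F y)⁻¹ • manifoldExtDeriv α y) z) (e y) =
        chartForm e ((-1 : ℂ) • manifoldExtDeriv δ) (e y) := by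
      change F (e.symm (e y)) •
        chartForm e (manifoldExtDeriv (fun y => (F y)⁻¹ • manifoldExtDeriv α y)) (e y) =
        (-1 : ℂ) • chartForm e (manifoldExtDeriv δ) (e y)
      rw [(chartForm_manifoldExtDeriv_eventually he hy.1 hτ).eq_of_nhds,
        (chartForm_manifoldExtDeriv_eventually he hy.1 hδy).eq_of_nhds, eτ.extDeriv_eq,
        eδ.extDeriv_eq, extDeriv_twisted hy.2.1 ((holomorphicFormAt_iff he hy.1).1 hβy) hF0]
      ext v
      simp
    exact chartForm_injective (α := fun z => F z •
      manifoldExtDeriv (fun y => (F y)⁻¹ • manifoldExtDeriv α y) z) he hy.1 key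
  · filter_upwards [hFe] with y hy hyD
    rw [smul_smul, mul_inv_cancel₀ (hy.2.2 hyD), one_smul]

/-- The exterior derivative `Ω^p(log D)(-D) → Ω^{p+1}(log D)(-D)`. -/
def minorLogDifferential (d p : ℕ) {X : Type u} [TopologicalSpace X]
    [ChartedSpace (Fin d → ℂ) X] [IsManifold 𝓘(ℂ, Fin d → ℂ) ω X] (D : Set X) :
    (minorLogCondition d p D).LocalOperator (minorLogCondition d (p + 1) D) where
  op := manifoldExtDeriv
  congr := manifoldExtDeriv_congr
  add h h' := manifoldExtDeriv_add (mem_minorLogCondition.1 h).holomorphic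
    (mem_minorLogCondition.1 h').holomorphic
  smul c _ _ := manifoldExtDeriv_const_smul c
  maps h := mem_minorLogCondition.2 (mem_minorLogCondition.1 h.self_of_nhds).extDeriv

/-- The minor log complex `Ω^•(log D)(-D) ⊆ Ω^•`, a complex of sheaves of complex vector spaces. -/
def minorLogComplex (d : ℕ) {X : Type u} [TopologicalSpace X]
    [ChartedSpace (Fin d → ℂ) X] [IsManifold 𝓘(ℂ, Fin d → ℂ) ω X] (D : Set X) :
    CochainComplex (TopCat.Sheaf (ModuleCat.{u} ℂ) (TopCat.of X)) ℕ :=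
  CochainComplex.of (fun p => (minorLogCondition d p D).sheaf)
    (fun p => (minorLogDifferential d p D).hom)
    (fun _ => GermCondition.LocalOperator.hom_comp_eq_zero _ _ fun h =>
      manifoldExtDeriv_manifoldExtDeriv (mem_minorLogCondition.1 h.self_of_nhds).holomorphic)

theorem minorLogComplex_d (d p : ℕ) {X : Type u} [TopologicalSpace X]
    [ChartedSpace (Fin d → ℂ) X] [IsManifold 𝓘(ℂ, Fin d → ℂ) ω X] (D : Set X) :
    (minorLogComplex d D).d p (p + 1) = (minorLogDifferential d p D).hom :=
  CochainComplex.of_d (fun p => (minorLogCondition d p D).sheaf)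
    (fun p => (minorLogDifferential d p D).hom) p

end

/-- The condition that defines `ℂ_{U!}`, the extension by zero of the constant sheaf on
`U = X \ D`: its sections over `V` are the locally constant functions on `V ∩ U` with support
closed in `V`, extended by `0` to `V ∩ D`; that is, the functions on `V` which are locally
constant at the points of `U` and vanish near the points of `D`. -/
def constExtByZeroCondition {X : Type u} [TopologicalSpace X] (D : Set X) :
    GermCondition (X := X) (fun _ => ℂ) where
  holds x :=
    { carrier := {s | (x ∉ D → ∀ᶠ y in 𝓝 x, s y = s x) ∧ (x ∈ D → ∀ᶠ y in 𝓝 x, s y = 0)}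
      zero_mem' := by simp
      add_mem' := by
        rintro s t ⟨hs, hs'⟩ ⟨ht, ht'⟩
        refine ⟨fun hx => ?_, fun hx => ?_⟩
        · filter_upwards [hs hx, ht hx] with y h h'
          simp [h, h']
        · filter_upwards [hs' hx, ht' hx] with y h h'
          simp [h, h']
      smul_mem' := by
        rintro c s ⟨hs, hs'⟩
        refine ⟨fun hx => ?_, fun hx => ?_⟩
        · filter_upwards [hs hx] with y h
          simp [h]
        · filter_upwards [hs' hx] with y h
          simp [h] }
  congr := by
    rintro x s t ⟨hs, hs'⟩ h
    refine ⟨fun hx => ?_, fun hx => ?_⟩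
    · filter_upwards [hs hx, h] with y k k'
      rw [← k', k, h.self_of_nhds]
    · filter_upwards [hs' hx, h] with y k k'
      rw [← k', k]

/-- The sections of `ℂ_{U!}` over `V` are the functions on `V` that vanish on `D`, are locally
constant on `V \ D`, and have closed support in `V`. -/
theorem mem_constExtByZero_sections_iff {X : Type u} [TopologicalSpace X] {D : Set X}
    {V : Opens X} {s : V → ℂ} : s ∈ (constExtByZeroCondition D).sections V ↔
      (∀ x : V, (x : X) ∈ D → s x = 0) ∧
      (∀ x : V, (x : X) ∉ D → ∀ᶠ y in 𝓝 x, s y = s x) ∧ IsClosed (Function.support s) := by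
  have hloc : ∀ (x : V) (c : ℂ),
      (∀ᶠ y in 𝓝 (x : X), extendSection (T := fun _ => ℂ) V s y = c) ↔ ∀ᶠ y in 𝓝 x, s y = c := by
    intro x c
    rw [← V.isOpen.isOpenEmbedding_subtypeVal.map_nhds_eq x, Filter.eventually_map]
    simp only [GermCondition.extendSection_apply]
    exact Iff.rfl
  have hmem : s ∈ (constExtByZeroCondition D).sections V ↔
      ∀ x : V, ((x : X) ∉ D → ∀ᶠ y in 𝓝 x, s y = s x) ∧ ((x : X) ∈ D → ∀ᶠ y in 𝓝 x, s y = 0) := by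
    refine forall_congr' fun x => ?_
    have h := hloc x (s x)
    rw [← hloc x 0, ← h, ← GermCondition.extendSection_apply (T := fun _ => ℂ) V s x]
    rfl
  rw [hmem]
  constructor
  · intro h
    refine ⟨fun x hx => ((h x).2 hx).self_of_nhds, fun x hx => (h x).1 hx, ?_⟩
    rw [← isOpen_compl_iff, isOpen_iff_mem_nhds]
    intro x hx
    have hx0 : s x = 0 := by simpa using hx
    have : ∀ᶠ y in 𝓝 x, s y = 0 := by
      by_cases hD : (x : X) ∈ D
      · exact (h x).2 hD
      · exact hx0 ▸ (h x).1 hD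
    filter_upwards [this] with y hy
    simpa using hy
  · rintro ⟨h1, h2, h3⟩ x
    refine ⟨h2 x, fun hx => ?_⟩
    filter_upwards [h3.isOpen_compl.mem_nhds (show x ∈ (Function.support s)ᶜ by simpa using h1 x hx)]
      with y hy
    simpa using hy

/-- `ℂ_{U!} = i_!(ℂ_U)` for the inclusion `i` of `U = X \ D` in `X`. -/
def constExtByZero {X : Type u} [TopologicalSpace X] (D : Set X) :
    TopCat.Sheaf (ModuleCat.{u} ℂ) (TopCat.of X) :=
  (constExtByZeroCondition D).sheaf

/-- A function, regarded as a `0`-form. -/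
def functionAsForm (d : ℕ) {X : Type u} [TopologicalSpace X] [ChartedSpace (Fin d → ℂ) X]
    (s : X → ℂ) (x : X) : FormFiber d 0 x :=
  ContinuousAlternatingMap.constOfIsEmpty ℂ (TangentSpace 𝓘(ℂ, Fin d → ℂ) x) (Fin 0) (s x)

section

variable {D : Set X} {s : X → ℂ} {x : X}

theorem chartForm_functionAsForm (e : OpenPartialHomeomorph X (Fin d → ℂ)) :
    chartForm e (functionAsForm d s) = fun y =>
      ContinuousAlternatingMap.constOfIsEmpty ℂ (Fin d → ℂ) (Fin 0) (s (e.symm y)) := rfl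

theorem constExtByZero_eventually_const (h : s ∈ (constExtByZeroCondition D).holds x) :
    ∀ᶠ y in 𝓝 x, s y = s x := by
  by_cases hx : x ∈ D
  · filter_upwards [h.2 hx] with y hy
    rw [hy, (h.2 hx).self_of_nhds]
  · exact h.1 hx


theorem holomorphicFormAt_functionAsForm (h : ∀ᶠ y in 𝓝 x, s y = s x) :
    HolomorphicFormAt (functionAsForm d s) x := by
  have h1 : HolomorphicFormAt (functionAsForm d fun _ => s x) x :=
    analyticAt_const (v := ContinuousAlternatingMap.constOfIsEmpty ℂ (Fin d → ℂ) (Fin 0) (s x))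
  refine h1.congr (h.mono fun y hy => ?_)
  rw [functionAsForm, functionAsForm, hy]

theorem manifoldExtDeriv_functionAsForm (h : ∀ᶠ y in 𝓝 x, s y = s x) :
    manifoldExtDeriv (functionAsForm d s) x = 0 := by
  have h1 : manifoldExtDeriv (functionAsForm d s) x =
      manifoldExtDeriv (functionAsForm d fun _ => s x) x := by
    refine manifoldExtDeriv_congr (h.mono fun y hy => ?_)
    rw [functionAsForm, functionAsForm, hy]
  rw [h1, manifoldExtDeriv, chartForm_functionAsForm, extDeriv, fderiv_const_apply,
    ← ContinuousAlternatingMap.alternatizeUncurryFinCLM_apply, map_zero]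
  rfl

variable [IsManifold 𝓘(ℂ, Fin d → ℂ) ω X]

theorem isMinorLogFormAt_functionAsForm (h : s ∈ (constExtByZeroCondition D).holds x) :
    IsMinorLogFormAt D (functionAsForm d s) x := by
  have hol := holomorphicFormAt_functionAsForm (d := d) (constExtByZero_eventually_const h)
  by_cases hx : x ∈ D
  · refine mem_minorLogCondition.1
      ((minorLogCondition d 0 D).congr (s := 0) (Submodule.zero_mem _) ?_)
    filter_upwards [h.2 hx] with y hy
    rw [functionAsForm, hy]
    rfl
  · refine ⟨hol, fun F hF => ?_⟩
    obtain ⟨e, he, hxe, hFe⟩ := hF.exists_chart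
    obtain ⟨-, hF1, hF2⟩ := hFe.self_of_nhds
    have hβ : HolomorphicFormAt (fun y => (F y)⁻¹ • functionAsForm d s y) x := by
      refine HolomorphicFormAt.fun_smul (F := fun y => (F y)⁻¹) he hxe (hF1.inv ?_) hol
      rw [e.left_inv hxe]
      exact hF2 hx
    refine ⟨fun y => (F y)⁻¹ • functionAsForm d s y,
      ⟨?_, ⟨_, hβ.fun_smul he hxe hF1, ?_⟩, ⟨_, hβ.extDeriv.fun_smul he hxe hF1, ?_⟩⟩, ?_⟩
    · filter_upwards [hβ.eventually] with y hy _ using hy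
    · exact .of_forall fun y _ => rfl
    · exact .of_forall fun y _ => rfl
    · filter_upwards [hFe] with y hy hyD
      rw [smul_smul, mul_inv_cancel₀ (hy.2.2 hyD), one_smul]

/-- The natural map from `ℂ_{U!}` to `Ω^0(log D)(-D) = 𝓞(-D)`. -/
def constToMinorLog (d : ℕ) {X : Type u} [TopologicalSpace X]
    [ChartedSpace (Fin d → ℂ) X] [IsManifold 𝓘(ℂ, Fin d → ℂ) ω X] (D : Set X) :
    (constExtByZeroCondition D).LocalOperator (minorLogCondition d 0 D) where
  op := functionAsForm d
  congr h := by rw [functionAsForm, functionAsForm, h.self_of_nhds]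
  add _ _ := rfl
  smul _ _ _ := rfl
  maps h := mem_minorLogCondition.2 (isMinorLogFormAt_functionAsForm h.self_of_nhds)

/-- The natural map of complexes from `ℂ_{U!}`, placed in degree `0`, to `Ω^•(log D)(-D)`. -/
def minorLogAugmentation (d : ℕ) {X : Type u} [TopologicalSpace X]
    [ChartedSpace (Fin d → ℂ) X] [IsManifold 𝓘(ℂ, Fin d → ℂ) ω X] (D : Set X) :
    (CochainComplex.single₀ _).obj (constExtByZero D) ⟶ minorLogComplex d D :=
  (CochainComplex.fromSingle₀Equiv (minorLogComplex d D) (constExtByZero D)).symm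
    ⟨(constToMinorLog d D).hom, by
      refine (congrArg (fun φ => (constToMinorLog d D).hom ≫ φ) (minorLogComplex_d d 0 D)).trans ?_
      exact GermCondition.LocalOperator.hom_comp_eq_zero _ _ fun h =>
        manifoldExtDeriv_functionAsForm (constExtByZero_eventually_const h.self_of_nhds)⟩

end

end MinorLog

end

/-!
A form belongs to `Ω^p(log D)(-D)` exactly when it is holomorphic and its pull-back to every local
component of `D` vanishes. In coordinates in which `D` is `P = ∏ xᵢ = 0`, a minor log form `a`
satisfies `P (da - δ) = dP ∧ a` with `δ` holomorphic, and at a generic point of `xᵢ = 0` this says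
`dxᵢ ∧ a = 0` (`IsMinorLogFormAt.vanishesAlong`). Conversely, if `a` pulls back to zero on
`xᵢ = 0`, then `dxᵢ ∧ a` is divisible by `xᵢ`, so `P d(P⁻¹ a) = da - ∑ xᵢ⁻¹ dxᵢ ∧ a` is holomorphic
(`HolomorphicFormAt.isMinorLogFormAt`). The definition of minor log forms refers to all local
equations of `D`; that vanishing along `D` does not depend on the adapted chart
(`VanishesAlong.change_chart`) follows from the fact that a vector space over `ℂ` is not a finite
union of proper subspaces.

With this description the Poincaré lemma is proved by the usual radial homotopy. In an adapted chart
with centre `c`, a closed form `a` of degree `p + 1` is the exterior derivative of the contraction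
of `∫₀¹ tᵖ a(c + t (y - c)) dt` with the radial vector field `R = y - c`
(`extDeriv_radial_primitive`). As `R` is tangent to the coordinate hyperplanes through `c`, the
primitive again vanishes along `D` (`exists_minorLog_primitive`). In degree `0`, a closed form is a
locally constant function, which vanishes near the points of `D`
(`exists_constExtByZero_of_closed`). So the augmented complex is exact on germs, and exactness of a
complex of sheaves can be tested on stalks.

Analyticity of the averages `g = ∫₀¹ tᵏ f(...) dt`, which also provide the quotients by `xᵢ`, is
obtained by writing them as a continuous linear functional of `t ↦ f(...)`, an analytic function of
the parameters with values in the Banach space of continuous maps on the unit interval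
(`AnalyticAt.exists_superposition`). Instead of differentiating under the integral sign one uses the
differential equation `(k + 1) g + R g = f` (`segmentAverage_euler`).
-/

/-! ### Exactness of complexes of sheaves is local -/

/-- A complex of sheaves of complex vector spaces is exact if every section killed by the second
map lifts locally along the first one. -/
theorem sheaf_exact_of_locally_lifts {X : TopCat.{u}}
    (S : ShortComplex (TopCat.Sheaf (ModuleCat.{u} ℂ) X))
    (h : ∀ (V : Opens X) (s : S.X₂.obj.obj (op V)), S.g.hom.app (op V) s = 0 → ∀ x ∈ V,
      ∃ (W : Opens X) (hW : W ≤ V), x ∈ W ∧ ∃ t : S.X₁.obj.obj (op W),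
        S.f.hom.app (op W) t = S.X₂.obj.map (homOfLE hW).op s) :
    S.Exact := by
  rw [TopCat.Sheaf.exact_iff_stalkFunctor_map_exact]
  intro x
  rw [ShortComplex.moduleCat_exact_iff]
  intro z hz
  obtain ⟨V, hxV, s, rfl⟩ := TopCat.Presheaf.exists_germ_eq (F := S.X₂.obj) z
  have h1 : TopCat.Presheaf.germ S.X₃.obj V x hxV (S.g.hom.app (op V) s) =
      TopCat.Presheaf.germ S.X₃.obj V x hxV 0 := by
    rw [map_zero, ← TopCat.Presheaf.stalkFunctor_map_germ_apply]
    exact hz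
  obtain ⟨V', hxV', i, i', h2⟩ := TopCat.Presheaf.germ_eq _ x hxV hxV _ _ h1
  rw [map_zero, ← NatTrans.naturality_apply] at h2
  obtain ⟨W, hW, hxW, t, ht⟩ := h V' _ h2 x hxV'
  refine ⟨TopCat.Presheaf.germ S.X₁.obj W x hxW t, ?_⟩
  refine (TopCat.Presheaf.stalkFunctor_map_germ_apply W x hxW S.f.hom t).trans ?_
  rw [ht, TopCat.Presheaf.germ_res_apply, TopCat.Presheaf.germ_res_apply]

namespace GermCondition.LocalOperator

variable {X : Type u} [TopologicalSpace X] {T T' T'' : X → Type}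
  [∀ x, AddCommGroup (T x)] [∀ x, Module ℂ (T x)]
  [∀ x, AddCommGroup (T' x)] [∀ x, Module ℂ (T' x)]
  [∀ x, AddCommGroup (T'' x)] [∀ x, Module ℂ (T'' x)]
  {A : GermCondition T} {B : GermCondition T'} {C : GermCondition T''}

theorem eventually_op_extendSection_eq_zero (M : LocalOperator B C) {V : Opens X}
    {s : B.sections V} (hs : M.onSections V s = 0) {x : X} (hx : x ∈ V) :
    ∀ᶠ y in 𝓝 x, M.op (extendSection V s.1) y = 0 := by
  filter_upwards [V.isOpen.mem_nhds hx] with y hy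
  exact congrFun (congrArg Subtype.val hs) ⟨y, hy⟩

/-- Two composable local operators give an exact sequence of sheaves if they are exact on germs. -/
theorem exact_of_germs (L : LocalOperator A B) (M : LocalOperator B C) (w : L.hom ≫ M.hom = 0)
    (h : ∀ (s : ∀ x, T' x) (x : X), (∀ᶠ y in 𝓝 x, s ∈ B.holds y) →
      (∀ᶠ y in 𝓝 x, M.op s y = 0) →
      ∃ t : ∀ x, T x, (∀ᶠ y in 𝓝 x, t ∈ A.holds y) ∧ ∀ᶠ y in 𝓝 x, L.op t y = s y) :
    (ShortComplex.mk L.hom M.hom w).Exact := by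
  apply sheaf_exact_of_locally_lifts
  intro V s hs x hx
  have hs1 : ∀ᶠ y in 𝓝 x, extendSection V s.1 ∈ B.holds y := by
    filter_upwards [V.isOpen.mem_nhds hx] with y hy using s.2 ⟨y, hy⟩
  obtain ⟨t, ht, hts⟩ := h _ x hs1 (M.eventually_op_extendSection_eq_zero hs hx)
  obtain ⟨W, hW, hWo, hxW⟩ :=
    eventually_nhds_iff.1 ((ht.and hts).and (V.isOpen.mem_nhds hx))
  have hext : ∀ y ∈ W, ∀ᶠ z in 𝓝 y, t z =
      extendSection (⟨W, hWo⟩ : Opens X) (fun z => t z) z := by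
    intro y hy
    filter_upwards [hWo.mem_nhds hy] with z hz
    exact (extendSection_apply (⟨W, hWo⟩ : Opens X) (fun z => t z) ⟨z, hz⟩).symm
  refine ⟨⟨W, hWo⟩, fun y hy => (hW y hy).2, hxW,
    ⟨fun y => t y, fun y => A.congr (hW y y.2).1.1 (hext y y.2)⟩, ?_⟩
  apply Subtype.ext
  funext y
  refine (L.congr ((hext y y.2).mono fun _ h => h.symm)).trans ?_
  refine (hW y y.2).1.2.trans ?_
  exact extendSection_apply V s.1 ⟨y, (hW y y.2).2⟩

theorem mono_hom_of_injective (L : LocalOperator A B)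
    (h : ∀ (s : ∀ x, T x) (x : X), L.op s x = 0 → s x = 0) : Mono L.hom := by
  refine ((ShortComplex.mk (0 : A.sheaf ⟶ A.sheaf) L.hom Limits.zero_comp).exact_iff_mono
    rfl).1 (sheaf_exact_of_locally_lifts _ fun V s hs x hx => ⟨V, le_rfl, hx, 0, ?_⟩)
  have h0 : s = 0 := by
    apply Subtype.ext
    funext y
    rw [← extendSection_apply V s.1 y]
    exact h _ _ (congrFun (congrArg Subtype.val hs) y)
  rw [h0, map_zero, map_zero]

end GermCondition.LocalOperator

/-- The augmentation is a quasi-isomorphism as soon as the augmented complex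
`0 → ℂ_{U!} → Ω⁰(log D)(-D) → Ω¹(log D)(-D) → ⋯` is exact. -/
theorem quasiIso_minorLogAugmentation {d : ℕ} {X : Type u} [TopologicalSpace X]
    [ChartedSpace (Fin d → ℂ) X] [IsManifold 𝓘(ℂ, Fin d → ℂ) ω X] {D : Set X}
    (h0 : ∀ w : (constToMinorLog d D).hom ≫ (minorLogDifferential d 0 D).hom = 0,
      (ShortComplex.mk _ _ w).Exact)
    (h1 : ∀ (p : ℕ)
      (w : (minorLogDifferential d p D).hom ≫ (minorLogDifferential d (p + 1) D).hom = 0),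
      (ShortComplex.mk _ _ w).Exact)
    (hm : Mono (constToMinorLog d D).hom) : QuasiIso (minorLogAugmentation d D) where
  quasiIsoAt n := by
    cases n with
    | zero =>
      have haug : (minorLogAugmentation d D).f 0 = (constToMinorLog d D).hom :=
        CochainComplex.fromSingle₀Equiv_symm_apply_f_zero (C := minorLogComplex d D) _ _
      rw [CochainComplex.quasiIsoAt₀_iff, ShortComplex.quasiIso_iff_of_zeros]
      · have w : (constToMinorLog d D).hom ≫ (minorLogDifferential d 0 D).hom = 0 := by
          rw [← minorLogComplex_d]
          exact ((CochainComplex.fromSingle₀Equiv (minorLogComplex d D) (constExtByZero D))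
            (minorLogAugmentation d D)).2
        refine (ShortComplex.exact_and_mono_f_iff_of_iso ?_).2 ⟨h0 w, hm⟩
        refine ShortComplex.isoMk (Iso.refl _) (Iso.refl _) (Iso.refl _) ?_ ?_
        · exact (Category.id_comp _).trans (haug.symm.trans (Category.comp_id _).symm)
        · exact (Category.id_comp _).trans
            ((minorLogComplex_d d 0 D).trans (Category.comp_id _).symm)
      all_goals rfl
    | succ n =>
      rw [quasiIsoAt_iff_exactAt]
      · rw [HomologicalComplex.exactAt_iff' _ n (n + 1) (n + 1 + 1) (by simp) (by simp)]
        have w : (minorLogDifferential d n D).hom ≫ (minorLogDifferential d (n + 1) D).hom = 0 := by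
          rw [← minorLogComplex_d, ← minorLogComplex_d]
          exact (minorLogComplex d D).d_comp_d _ _ _
        refine (ShortComplex.exact_iff_of_iso ?_).2 (h1 n w)
        refine ShortComplex.isoMk (Iso.refl _) (Iso.refl _) (Iso.refl _) ?_ ?_
        · exact (Category.id_comp _).trans
            ((minorLogComplex_d d n D).symm.trans (Category.comp_id _).symm)
        · exact (Category.id_comp _).trans
            ((minorLogComplex_d d (n + 1) D).symm.trans (Category.comp_id _).symm)
      · apply CochainComplex.exactAt_succ_single_obj

/-! ### Averages of holomorphic maps along segments -/

section Averages

variable {E F : Type*} [NormedAddCommGroup E] [NormedSpace ℂ E] [NormedAddCommGroup F]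
  [NormedSpace ℂ F]

/-- Composition with `f`, as an operation on the maps from a compact space to the domain of `f`, is
analytic: its power series is that of `f`, evaluated pointwise. -/
theorem AnalyticAt.exists_superposition [CompleteSpace F] {K : Type*} [TopologicalSpace K]
    [CompactSpace K] {f : E → F} {c : E} (hf : AnalyticAt ℂ f c) :
    ∃ Φ : C(K, E) → C(K, F), AnalyticAt ℂ Φ 0 ∧
      ∀ᶠ u in 𝓝 (0 : C(K, E)), ∀ t, Φ u t = f (c + u t) := by
  obtain ⟨q, r, hq⟩ := hf
  let P : FormalMultilinearSeries ℂ C(K, E) C(K, F) := fun n =>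
    MultilinearMap.mkContinuous
      { toFun := fun u => ⟨fun t => q n fun i => u i t, by fun_prop⟩
        map_update_add' := fun u i x y => by
          ext t
          have h : ∀ z : C(K, E), (fun j => Function.update u i z j t) =
              Function.update (fun j => u j t) i (z t) := fun z => by
            funext j
            by_cases hj : j = i
            · subst hj
              simp
            · simp [hj]
          simp [h]
        map_update_smul' := fun u i a x => by
          ext t
          have h : ∀ z : C(K, E), (fun j => Function.update u i z j t) =
              Function.update (fun j => u j t) i (z t) := fun z => by
            funext j
            by_cases hj : j = i
            · subst hj
              simp
            · simp [hj]
          simp [h] }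
      ‖q n‖ fun u => by
        rw [ContinuousMap.norm_le _ (by positivity)]
        intro t
        refine ((q n).le_opNorm _).trans ?_
        gcongr with i
        exact (u i).norm_coe_le_norm t
  have hP : ∀ n, ‖P n‖ ≤ ‖q n‖ := fun n => MultilinearMap.mkContinuous_norm_le _ (norm_nonneg _) _
  have hrad : r ≤ P.radius := hq.r_le.trans (FormalMultilinearSeries.radius_le_of_le hP)
  have hΦ := P.hasFPowerSeriesOnBall (hq.r_pos.trans_le hrad)
  refine ⟨P.sum, hΦ.analyticAt, ?_⟩
  filter_upwards [Metric.eball_mem_nhds (0 : C(K, E)) hq.r_pos] with u hu t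
  have hu' : u t ∈ Metric.eball (0 : E) r := by
    rw [mem_eball_zero_iff] at hu ⊢
    refine lt_of_le_of_lt ?_ hu
    rw [enorm_le_iff_norm_le]
    exact u.norm_coe_le_norm t
  have h1 := hΦ.hasSum (Metric.eball_subset_eball hrad hu)
  rw [zero_add] at h1
  exact ((ContinuousMap.evalCLM ℂ t).hasSum h1).unique (hq.hasSum hu')

/-- The average `∫₀¹ tᵏ f(c + (v - A v) + t A v) dt`, where `v = y - c`, of `f` along the segment
from `c + (v - A v)` to `y`. -/
noncomputable def segmentAverage (A : E →L[ℂ] E) (k : ℕ) (f : E → F) (c y : E) : F :=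
  ∫ t in (0 : ℝ)..1, (t : ℂ) ^ k • f (c + (y - c + ((t : ℂ) - 1) • A (y - c)))

/-- The moment `∫₀¹ tᵏ u(t) dt` of a continuous function on the unit interval. -/
noncomputable def momentCLM [CompleteSpace F] (k : ℕ) : C(unitInterval, F) →L[ℂ] F :=
  LinearMap.mkContinuous
    { toFun := fun u => ∫ t in (0 : ℝ)..1, (t : ℂ) ^ k • u (Set.projIcc 0 1 zero_le_one t)
      map_add' := fun u v => by
        simp only [ContinuousMap.add_apply, smul_add]
        exact intervalIntegral.integral_add (Continuous.intervalIntegrable (by fun_prop) _ _)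
          (Continuous.intervalIntegrable (by fun_prop) _ _)
      map_smul' := fun a u => by
        simp only [ContinuousMap.smul_apply, smul_comm _ a, RingHom.id_apply]
        exact intervalIntegral.integral_smul a _ }
    1 fun u => by
      have h := intervalIntegral.norm_integral_le_of_norm_le_const (a := (0 : ℝ)) (b := 1)
        (C := ‖u‖) (f := fun t => (t : ℂ) ^ k • u (Set.projIcc 0 1 zero_le_one t)) ?_
      · simpa using h
      · intro t ht
        rw [Set.uIoc_of_le zero_le_one] at ht
        rw [norm_smul, norm_pow, Complex.norm_real, Real.norm_of_nonneg ht.1.le]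
        calc t ^ k * ‖u (Set.projIcc 0 1 zero_le_one t)‖ ≤ 1 * ‖u‖ :=
              mul_le_mul (pow_le_one₀ ht.1.le ht.2) (u.norm_coe_le_norm _) (norm_nonneg _)
                zero_le_one
          _ = ‖u‖ := one_mul _

theorem analyticAt_segmentAverage [CompleteSpace F] [FiniteDimensional ℂ E] {f : E → F} {c : E}
    (hf : AnalyticAt ℂ f c) (A : E →L[ℂ] E) (k : ℕ) :
    AnalyticAt ℂ (segmentAverage A k f c) c := by
  obtain ⟨Φ, hΦ, hΦf⟩ := hf.exists_superposition (K := unitInterval)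
  let S : E →L[ℂ] C(unitInterval, E) := LinearMap.toContinuousLinearMap
    { toFun := fun v => ⟨fun t => v + ((t : ℂ) - 1) • A v, by fun_prop⟩
      map_add' := fun v w => by
        ext t
        simp only [map_add, smul_add, ContinuousMap.coe_mk, ContinuousMap.add_apply]
        abel
      map_smul' := fun a v => by
        ext t
        simp [smul_comm _ a] }
  have hS : AnalyticAt ℂ (fun y => S (y - c)) c :=
    (S.analyticAt _).comp (analyticAt_id.sub analyticAt_const)
  have hS0 : S (c - c) = 0 := by rw [sub_self, map_zero]
  have h1 : AnalyticAt ℂ (fun y => momentCLM (F := F) k (Φ (S (y - c)))) c := by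
    refine ((momentCLM (F := F) k).analyticAt _).comp (f := fun y => Φ (S (y - c))) ?_
    exact AnalyticAt.comp (g := Φ) (f := fun y => S (y - c)) (hS0.symm ▸ hΦ) hS
  refine h1.congr ?_
  have h2 : Tendsto (fun y => S (y - c)) (𝓝 c) (𝓝 0) := by
    have := hS.continuousAt
    rwa [ContinuousAt, hS0] at this
  filter_upwards [h2.eventually hΦf] with y hy
  refine intervalIntegral.integral_congr fun t ht => ?_
  rw [Set.uIcc_of_le zero_le_one] at ht
  simp only [hy, Set.projIcc_of_mem _ ht]
  rfl

/-- Near `c`, the segments that enter the averages stay in a given neighbourhood of `c`. They are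
prolonged to the parameter interval `[0, 2]`, of which `1` is an interior point. -/
theorem eventually_segment {c : E} (A : E →L[ℂ] E) {s : Set E} (hs : s ∈ 𝓝 c) :
    ∀ᶠ y in 𝓝 c, ∀ t ∈ Set.Icc (0 : ℝ) 2, c + (y - c + ((t : ℂ) - 1) • A (y - c)) ∈ s := by
  obtain ⟨r, hr, hrs⟩ := Metric.mem_nhds_iff.1 hs
  have h : ContinuousAt (fun y : E => ‖y - c‖ + ‖A (y - c)‖) c := by fun_prop
  have h' := h.eventually_lt (continuousAt_const (y := r)) (by simpa using hr)
  filter_upwards [h'] with y hy t ht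
  apply hrs
  rw [mem_ball_iff_norm, add_sub_cancel_left]
  refine lt_of_le_of_lt (norm_add_le _ _) (lt_of_le_of_lt ?_ hy)
  gcongr
  rw [norm_smul]
  refine mul_le_of_le_one_left (norm_nonneg _) ?_
  rw [← Complex.ofReal_one, ← Complex.ofReal_sub, Complex.norm_real, Real.norm_eq_abs, abs_le]
  constructor <;> linarith [ht.1, ht.2]

/-- If `A` is a projection and `R = A (y - c)` the corresponding Euler vector field, the average `g`
of `f` solves the differential equation `(k + 1) g + R g = f`. -/
theorem segmentAverage_euler [CompleteSpace F] [FiniteDimensional ℂ E] {f : E → F} {c : E}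
    (hf : AnalyticAt ℂ f c) {A : E →L[ℂ] E} (hA : ∀ v, A (A v) = A v) (k : ℕ) :
    ∀ᶠ y in 𝓝 c, ((k : ℂ) + 1) • segmentAverage A k f c y +
      fderiv ℂ (segmentAverage A k f c) y (A (y - c)) = f y := by
  filter_upwards [eventually_segment A hf.eventually_analyticAt,
    (analyticAt_segmentAverage hf A k).eventually_analyticAt] with y hy hgy
  set g := segmentAverage A k f c
  set v := y - c with hv
  have hcy : c + v = y := by rw [hv]; abel
  -- both sides are the derivative at `s = 1` of `sᵏ⁺¹ g(c + (v - A v) + s A v)`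
  have key : ∀ s : ℝ, (s : ℂ) ^ (k + 1) • g (c + (v + ((s : ℂ) - 1) • A v)) =
      ∫ t in (0 : ℝ)..s, (t : ℂ) ^ k • f (c + (v + ((t : ℂ) - 1) • A v)) := by
    intro s
    have h := intervalIntegral.smul_integral_comp_mul_left (a := 0) (b := 1)
      (fun t : ℝ => (t : ℂ) ^ k • f (c + (v + ((t : ℂ) - 1) • A v))) s
    rw [mul_zero, mul_one] at h
    rw [← h, pow_succ', mul_smul, Complex.coe_smul]
    congr 1
    change _ • (∫ t in (0 : ℝ)..1, _) = _
    rw [← intervalIntegral.integral_smul]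
    refine intervalIntegral.integral_congr fun t _ => ?_
    simp only [add_sub_cancel_left, map_add, map_smul, hA, Complex.ofReal_mul, mul_pow, smul_smul,
      smul_add]
    congr 2
    rw [add_assoc]
    congr 2
    rw [← add_smul, ← add_smul]
    congr 1
    ring
  have hcont : ContinuousOn (fun t : ℝ => (t : ℂ) ^ k • f (c + (v + ((t : ℂ) - 1) • A v)))
      (Set.Icc 0 2) := by
    intro t ht
    have h1 : ContinuousAt f (c + (v + ((t : ℂ) - 1) • A v)) := (hy t ht).continuousAt
    have h2 : ContinuousAt (fun t : ℝ => c + (v + ((t : ℂ) - 1) • A v)) t := by fun_prop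
    exact (ContinuousAt.smul (by fun_prop) (ContinuousAt.comp
      (f := fun t : ℝ => c + (v + ((t : ℂ) - 1) • A v)) h1 h2)).continuousWithinAt
  have h12 : Set.Icc (0 : ℝ) 2 ∈ 𝓝 (1 : ℝ) := Icc_mem_nhds (by norm_num) (by norm_num)
  have hR : HasDerivAt (fun s : ℝ => ∫ t in (0 : ℝ)..s,
      (t : ℂ) ^ k • f (c + (v + ((t : ℂ) - 1) • A v))) (f y) 1 := by
    have := intervalIntegral.integral_hasDerivAt_right (a := 0) (b := 1)
      (f := fun t : ℝ => (t : ℂ) ^ k • f (c + (v + ((t : ℂ) - 1) • A v)))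
      (ContinuousOn.intervalIntegrable_of_Icc zero_le_one
        (hcont.mono (Set.Icc_subset_Icc_right one_le_two)))
      (ContinuousOn.stronglyMeasurableAtFilter_nhdsWithin hcont measurableSet_Icc 1 |>.filter_mono
        (nhdsWithin_eq_nhds.2 h12).ge)
      (hcont.continuousAt h12)
    simpa [hcy] using this
  have hline : HasDerivAt (fun z : ℂ => c + (v + (z - 1) • A v)) (A v) 1 := by
    simpa using ((((hasDerivAt_id (1 : ℂ)).sub_const 1).smul_const (A v)).const_add v).const_add c
  have hL : HasDerivAt (fun z : ℂ => z ^ (k + 1) • g (c + (v + (z - 1) • A v)))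
      (((k : ℂ) + 1) • g y + fderiv ℂ g y (A v)) 1 := by
    have hg : HasFDerivAt g (fderiv ℂ g y) (c + (v + ((1 : ℂ) - 1) • A v)) := by
      simpa [hcy] using hgy.differentiableAt.hasFDerivAt
    refine ((hasDerivAt_pow (k + 1) (1 : ℂ)).smul
      (hg.comp_hasDerivAt (1 : ℂ) hline)).congr_deriv ?_
    simp [hcy, add_comm]
  rw [← Complex.ofReal_one] at hL
  have hL' := (hL.hasFDerivAt.restrictScalars ℝ).comp_hasDerivAt (1 : ℝ)
    Complex.ofRealCLM.hasDerivAt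
  simp only [ContinuousLinearMap.coe_restrictScalars', Complex.ofRealCLM_apply,
    ContinuousLinearMap.toSpanSingleton_apply, Complex.ofReal_one, one_smul] at hL'
  exact hL'.unique (hR.congr_of_eventuallyEq (.of_forall key))

theorem AnalyticAt.clm_apply {G : Type*} [NormedAddCommGroup G] [NormedSpace ℂ G] [CompleteSpace F]
    [CompleteSpace G] {T : E → F →L[ℂ] G} {u : E → F} {x : E} (hT : AnalyticAt ℂ T x)
    (hu : AnalyticAt ℂ u x) : AnalyticAt ℂ (fun y => T y (u y)) x :=
  ((hT.contDiffAt (n := ω)).clm_apply (hu.contDiffAt (n := ω))).analyticAt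

theorem hasDerivAt_comp_real_line {f : E → F} {x u : E} {t : ℝ} {a : ℂ}
    (hf : DifferentiableAt ℂ f (x + ((t : ℂ) - a) • u)) :
    HasDerivAt (fun s : ℝ => f (x + ((s : ℂ) - a) • u))
      (fderiv ℂ f (x + ((t : ℂ) - a) • u) u) t := by
  have hline : HasDerivAt (fun s : ℝ => x + ((s : ℂ) - a) • u) u t := by
    simpa using ((Complex.ofRealCLM.hasDerivAt (x := t)).sub_const a).smul_const u |>.const_add x
  exact (hf.hasFDerivAt.restrictScalars ℝ).comp_hasDerivAt t hline

/-- An analytic map that vanishes on the hyperplane `l = 0` is divisible by the linear form `l`: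
the quotient is the average of the derivative along the segments transverse to the hyperplane. -/
theorem AnalyticAt.exists_eq_smul_of_eq_zero_on_hyperplane [CompleteSpace F] [CompleteSpace E]
    [FiniteDimensional ℂ E] {f : E → F} {c e : E} {l : E →L[ℂ] ℂ} (hf : AnalyticAt ℂ f c)
    (he : l e = 1) (hc : l c = 0)
    (h0 : ∀ᶠ y in 𝓝 c, l y = 0 → f y = 0) :
    ∃ g : E → F, AnalyticAt ℂ g c ∧ ∀ᶠ y in 𝓝 c, f y = l y • g y := by
  have hdf : AnalyticAt ℂ (fun y => fderiv ℂ f y e) c := hf.fderiv.clm_apply analyticAt_const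
  refine ⟨_, analyticAt_segmentAverage hdf (l.smulRight e) 0, ?_⟩
  filter_upwards [eventually_segment (l.smulRight e) hf.eventually_analyticAt,
    eventually_segment (l.smulRight e) h0] with y hy hy0
  have hly : l (y - c) = l y := by rw [map_sub, hc, sub_zero]
  have hmem : ∀ t ∈ Set.uIcc (0 : ℝ) 1, t ∈ Set.Icc (0 : ℝ) 2 := fun t ht => by
    rw [Set.uIcc_of_le zero_le_one] at ht
    exact ⟨ht.1, ht.2.trans one_le_two⟩
  simp only [ContinuousLinearMap.smulRight_apply, hly, ← add_assoc, add_sub_cancel] at hy hy0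
  have hftc := intervalIntegral.integral_eq_sub_of_hasDerivAt
    (f := fun t : ℝ => f (y + ((t : ℂ) - 1) • l y • e))
    (f' := fun t : ℝ => fderiv ℂ f (y + ((t : ℂ) - 1) • l y • e) (l y • e)) (a := 0) (b := 1)
    (fun t ht => hasDerivAt_comp_real_line (hy t (hmem t ht)).differentiableAt)
    (ContinuousOn.intervalIntegrable fun t ht => by
      have h1 : ContinuousAt (fderiv ℂ f) (y + ((t : ℂ) - 1) • l y • e) :=
        (hy t (hmem t ht)).fderiv.continuousAt
      have h2 : ContinuousAt (fun t : ℝ => y + ((t : ℂ) - 1) • l y • e) t := by fun_prop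
      exact ((h1.comp (f := fun t : ℝ => y + ((t : ℂ) - 1) • l y • e) h2).clm_apply
        continuousAt_const).continuousWithinAt)
  have hstart : f (y + ((0 : ℝ) - 1 : ℂ) • l y • e) = 0 :=
    hy0 0 ⟨le_rfl, zero_le_two⟩ (by simp [he])
  rw [hstart, Complex.ofReal_one, sub_self, zero_smul, add_zero, sub_zero] at hftc
  rw [← hftc, segmentAverage, ← intervalIntegral.integral_smul]
  refine intervalIntegral.integral_congr fun t _ => ?_
  simp [hly, ← add_assoc]

/-- The only analytic solution near `c` of the Euler equation `(k + 1) h + R h = 0` is `0`. -/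
theorem AnalyticAt.eventually_eq_zero_of_euler [CompleteSpace F] {h : E → F} {c : E} {k : ℕ}
    (hh : AnalyticAt ℂ h c)
    (heq : ∀ᶠ y in 𝓝 c, ((k : ℂ) + 1) • h y + fderiv ℂ h y (y - c) = 0) :
    ∀ᶠ y in 𝓝 c, h y = 0 := by
  filter_upwards [eventually_segment (.id ℂ E) (hh.eventually_analyticAt.and heq)] with y hy
  have hseg : ∀ t : ℝ, c + (y - c + ((t : ℂ) - 1) • (y - c)) = c + ((t : ℂ) - 0) • (y - c) := by
    intro t
    module
  simp only [ContinuousLinearMap.id_apply, hseg] at hy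
  -- `tᵏ⁺¹ h` is constant along the rays from `c`
  have hder : ∀ t ∈ Set.uIcc (0 : ℝ) 1, HasDerivAt
      (fun t : ℝ => (t : ℂ) ^ (k + 1) • h (c + ((t : ℂ) - 0) • (y - c))) 0 t := by
    intro t ht
    rw [Set.uIcc_of_le zero_le_one] at ht
    obtain ⟨h1, h2⟩ := hy t ⟨ht.1, ht.2.trans one_le_two⟩
    have hp : HasDerivAt (fun t : ℝ => (t : ℂ) ^ (k + 1)) ((k + 1 : ℕ) * (t : ℂ) ^ k) t := by
      simpa using (Complex.ofRealCLM.hasDerivAt (x := t)).fun_pow (k + 1)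
    refine (hp.smul (hasDerivAt_comp_real_line h1.differentiableAt)).congr_deriv ?_
    have h3 := congrArg (fun w => (t : ℂ) ^ k • w) h2
    simp only [smul_add, smul_zero, add_sub_cancel_left, sub_zero, map_smul, smul_smul] at h3 ⊢
    rw [← h3, pow_succ, add_comm]
    push_cast
    rw [mul_comm ((k : ℂ) + 1)]
  have hftc := intervalIntegral.integral_eq_sub_of_hasDerivAt hder intervalIntegrable_const
  simpa using hftc.symm

end Averages

/-! ### The Poincaré lemma for holomorphic forms -/

section Poincare

variable {E F : Type*} [NormedAddCommGroup E] [NormedSpace ℂ E] [NormedAddCommGroup F]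
  [NormedSpace ℂ F]

open ContinuousAlternatingMap

theorem analyticAt_bilinear_radial {G H : Type*} [NormedAddCommGroup G] [NormedSpace ℂ G]
    [NormedAddCommGroup H] [NormedSpace ℂ H] [CompleteSpace E] [CompleteSpace H]
    (κ : G →L[ℂ] E →L[ℂ] H) {g : E → G} {c : E} (hg : AnalyticAt ℂ g c) :
    AnalyticAt ℂ (fun y => κ (g y) (y - c)) c :=
  AnalyticAt.clm_apply ((κ.analyticAt (g c)).comp hg) (analyticAt_id.sub analyticAt_const)

theorem hasFDerivAt_bilinear_radial {G H : Type*} [NormedAddCommGroup G] [NormedSpace ℂ G]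
    [NormedAddCommGroup H] [NormedSpace ℂ H] (κ : G →L[ℂ] E →L[ℂ] H) {g : E → G} {c y : E}
    (hg : DifferentiableAt ℂ g y) :
    HasFDerivAt (fun y => κ (g y) (y - c))
      (κ (g y) + (κ.comp (fderiv ℂ g y)).flip (y - c)) y :=
  (κ.hasFDerivAt.comp y hg.hasFDerivAt).clm_apply ((hasFDerivAt_id y).sub_const c)

/-- The algebraic part of Cartan's formula: contracting `T` with `R` before and after
antisymmetrization. -/
theorem alternatizeUncurryFin_curryLeft_flip {n : ℕ} (T : E →L[ℂ] E [⋀^Fin (n + 1)]→L[ℂ] F) (R : E)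
    (S : E →L[ℂ] E [⋀^Fin n]→L[ℂ] F) (hS : ∀ v, S v = (T v).curryLeft R) :
    alternatizeUncurryFin S = T R - (alternatizeUncurryFin T).curryLeft R := by
  ext w
  rw [ContinuousAlternatingMap.sub_apply, curryLeft_apply_apply, alternatizeUncurryFin_apply,
    alternatizeUncurryFin_apply, Fin.sum_univ_succ (n := n + 1)]
  simp only [hS, curryLeft_apply_apply]
  have h : ∀ i : Fin (n + 1), i.succ.removeNth (Matrix.vecCons R w) =
      Matrix.vecCons R (i.removeNth w) := by
    intro i
    funext j
    refine Fin.cases ?_ (fun j => ?_) j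
    · rfl
    · simp [Fin.removeNth, Matrix.vecCons]
  simp [h, pow_succ, Finset.sum_neg_distrib]

/-- The **Poincaré lemma**: near `c`, a closed holomorphic form `a` of positive degree is the
exterior derivative of the contraction of an average of `a` with the radial vector field. -/
theorem extDeriv_radial_primitive [CompleteSpace E] [FiniteDimensional ℂ E] {p : ℕ}
    {a : E → E [⋀^Fin (p + 1)]→L[ℂ] ℂ} {c : E} (ha : AnalyticAt ℂ a c)
    (hda : ∀ᶠ y in 𝓝 c, extDeriv a y = 0) :
    AnalyticAt ℂ (fun y => (segmentAverage (.id ℂ E) p a c y).curryLeft (y - c)) c ∧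
    ∀ᶠ y in 𝓝 c,
      extDeriv (fun y => (segmentAverage (.id ℂ E) p a c y).curryLeft (y - c)) y = a y := by
  have hg := analyticAt_segmentAverage ha (.id ℂ E) p
  have heuler := segmentAverage_euler ha (A := .id ℂ E) (fun _ => rfl) p
  set g := segmentAverage (.id ℂ E) p a c
  simp only [ContinuousLinearMap.id_apply] at heuler
  let κ : (E [⋀^Fin (p + 1)]→L[ℂ] ℂ) →L[ℂ] E →L[ℂ] E [⋀^Fin p]→L[ℂ] ℂ :=
    (curryLeftLI (𝕜 := ℂ) (E := E) (F := ℂ) (n := p)).toContinuousLinearMap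
  -- the exterior derivative of the average satisfies a homogeneous Euler equation
  -- `(p + 2) dg + R dg = da = 0`, hence it vanishes
  have hdg : ∀ᶠ y in 𝓝 c, extDeriv g y = 0 := by
    refine AnalyticAt.eventually_eq_zero_of_euler (k := p + 1) (analyticAt_extDeriv hg) ?_
    filter_upwards [heuler.eventually_nhds, hda, hg.eventually_analyticAt] with y hy hy0 hgy
    have hD := hgy.fderiv.differentiableAt.hasFDerivAt
    have h1 := (hgy.differentiableAt.hasFDerivAt.const_smul ((p : ℂ) + 1)).add
      (hD.clm_apply ((hasFDerivAt_id y).sub_const c))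
    have h2 := (h1.congr_of_eventuallyEq (f₁ := a) (hy.mono fun z hz => hz.symm)).fderiv
    have hsymm : IsSymmSndFDerivAt ℂ g y :=
      ContDiffAt.isSymmSndFDerivAt (n := ω) hgy.contDiffAt (by simp)
    have h3 : fderiv ℂ a y = ((p : ℂ) + 1 + 1) • fderiv ℂ g y +
        fderiv ℂ (fderiv ℂ g) y (y - c) := by
      rw [h2]
      ext1 v
      have := hsymm v (y - c)
      simp only [_root_.add_apply, _root_.smul_apply, ContinuousLinearMap.comp_apply,
        ContinuousLinearMap.flip_apply, ContinuousLinearMap.id_apply, id, this]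
      module
    have h4 : fderiv ℂ (extDeriv g) y (y - c) =
        alternatizeUncurryFin (fderiv ℂ (fderiv ℂ g) y (y - c)) := by
      have := (alternatizeUncurryFinCLM ℂ E ℂ (n := p + 1)).hasFDerivAt.comp y hD
      exact congrArg (fun T => T (y - c)) this.fderiv
    rw [extDeriv, h3, alternatizeUncurryFin_add, alternatizeUncurryFin_smul] at hy0
    rw [h4]
    push_cast
    exact hy0
  refine ⟨analyticAt_bilinear_radial κ hg, ?_⟩
  filter_upwards [heuler, hdg, hg.eventually_analyticAt] with y hy hy0 hgy
  have h1 := hasFDerivAt_bilinear_radial κ (c := c) hgy.differentiableAt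
  have h2 : alternatizeUncurryFin ((κ.comp (fderiv ℂ g y)).flip (y - c)) = _ :=
    alternatizeUncurryFin_curryLeft_flip (fderiv ℂ g y) (y - c) _ fun v => rfl
  have h3 : extDeriv (fun y => (g y).curryLeft (y - c)) y =
      alternatizeUncurryFin (κ (g y) + (κ.comp (fderiv ℂ g y)).flip (y - c)) := by
    exact congrArg alternatizeUncurryFin h1.fderiv
  have h4 : alternatizeUncurryFin (κ (g y)) = (p + 1) • g y := alternatizeUncurryFin_curryLeft _
  rw [h3, alternatizeUncurryFin_add, h2, h4, ← hy]
  change _ + (_ - (extDeriv g y).curryLeft _) = _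
  rw [hy0]
  simp [add_smul, Nat.cast_smul_eq_nsmul]

end Poincare

/-! ### Wedge products with covectors -/

section Wedge

variable {E : Type*} [NormedAddCommGroup E] [NormedSpace ℂ E] {p : ℕ}

open ContinuousAlternatingMap

/-- The product `l ∧ a` of a covector and a `p`-form, as a continuous bilinear map. -/
noncomputable def covectorWedge (E : Type*) [NormedAddCommGroup E] [NormedSpace ℂ E] (p : ℕ) :
    (E →L[ℂ] ℂ) →L[ℂ] (E [⋀^Fin p]→L[ℂ] ℂ) →L[ℂ] (E [⋀^Fin (p + 1)]→L[ℂ] ℂ) :=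
  (ContinuousLinearMap.compL ℂ (E [⋀^Fin p]→L[ℂ] ℂ) (E →L[ℂ] E [⋀^Fin p]→L[ℂ] ℂ)
    (E [⋀^Fin (p + 1)]→L[ℂ] ℂ) (alternatizeUncurryFinCLM ℂ E ℂ)).comp
    (ContinuousLinearMap.smulRightL ℂ E (E [⋀^Fin p]→L[ℂ] ℂ))

theorem covectorWedge_eq (l : E →L[ℂ] ℂ) (a : E [⋀^Fin p]→L[ℂ] ℂ) :
    covectorWedge E p l a = alternatizeUncurryFin (l.smulRight a) := rfl

theorem covectorWedge_apply (l : E →L[ℂ] ℂ) (a : E [⋀^Fin p]→L[ℂ] ℂ) (v : Fin (p + 1) → E) :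
    covectorWedge E p l a v =
      ∑ k : Fin (p + 1), (-1) ^ (k : ℕ) * (l (v k) * a (k.removeNth v)) := by
  rw [covectorWedge_eq, alternatizeUncurryFin_apply]
  simp [zsmul_eq_mul]

/-- On vectors of which all but the first lie in the kernel of `l`, only one term of `l ∧ a` is
left. -/
theorem covectorWedge_cons (l : E →L[ℂ] ℂ) (a : E [⋀^Fin p]→L[ℂ] ℂ) (u : E) (v : Fin p → E)
    (hv : ∀ k, l (v k) = 0) : covectorWedge E p l a (Matrix.vecCons u v) = l u * a v := by
  rw [covectorWedge_apply, Fin.sum_univ_succ]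
  simp [hv]

theorem extDeriv_smul_eq {g : E → ℂ} {b : E → E [⋀^Fin p]→L[ℂ] ℂ} {z : E}
    (hg : DifferentiableAt ℂ g z) (hb : DifferentiableAt ℂ b z) :
    extDeriv (fun y => g y • b y) z = g z • extDeriv b z + covectorWedge E p (fderiv ℂ g z) (b z) :=
  extDeriv_fun_smul' hg hb

end Wedge

theorem covectorWedge_proj_eq_zero {d p : ℕ} (i : Fin d) {a : (Fin d → ℂ) [⋀^Fin p]→L[ℂ] ℂ}
    (ha : ∀ v : Fin p → Fin d → ℂ, (∀ k, v k i = 0) → a v = 0) :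
    covectorWedge (Fin d → ℂ) p (ContinuousLinearMap.proj i) a = 0 := by
  -- it suffices to evaluate on distinct vectors of the standard basis
  have h : (covectorWedge (Fin d → ℂ) p (ContinuousLinearMap.proj i) a).toAlternatingMap = 0 := by
    refine Module.Basis.ext_alternating (Pi.basisFun ℂ (Fin d)) fun s hs => ?_
    refine (covectorWedge_apply _ _ _).trans (Finset.sum_eq_zero fun k _ => ?_)
    by_cases hk : s k = i
    · rw [ha, mul_zero, mul_zero]
      intro j
      have : s (k.succAbove j) ≠ i := fun h => Fin.succAbove_ne k j (hs (h.trans hk.symm))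
      simp [Fin.removeNth, this.symm]
    · simp [Ne.symm hk]
  ext v
  exact congrArg (fun T : (Fin d → ℂ) [⋀^Fin (p + 1)]→ₗ[ℂ] ℂ => T v) h

/-! ### Forms that vanish along the components of the divisor -/

section Vanishing

theorem eq_of_eventually_eq_on_line {E F : Type*} [NormedAddCommGroup E] [NormedSpace ℂ E]
    [TopologicalSpace F] [T2Space F] {f g : E → F} {z : E} (w : E) (hf : ContinuousAt f z)
    (hg : ContinuousAt g z) (h : ∀ᶠ t : ℂ in 𝓝[≠] 0, f (z + t • w) = g (z + t • w)) :
    f z = g z := by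
  have hl : Tendsto (fun t : ℂ => z + t • w) (𝓝[≠] 0) (𝓝 z) := by
    have : Continuous fun t : ℂ => z + t • w := by fun_prop
    simpa using (this.tendsto 0).mono_left nhdsWithin_le_nhds
  exact tendsto_nhds_unique_of_eventuallyEq (hf.tendsto.comp hl) (hg.tendsto.comp hl) h

theorem eventually_prod_add_ne_zero {ι : Type*} (J : Finset ι) (z : ι → ℂ) :
    ∀ᶠ t : ℂ in 𝓝[≠] 0, ∏ i ∈ J, (z i + t) ≠ 0 := by
  have h : ∀ i ∈ J, ∀ᶠ t : ℂ in 𝓝[≠] 0, z i + t ≠ 0 := by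
    intro i _
    by_cases hz : z i = 0
    · filter_upwards [self_mem_nhdsWithin] with t ht
      simpa [hz] using ht
    · have : ContinuousAt (fun t : ℂ => z i + t) 0 := by fun_prop
      exact (this.eventually_ne (by simpa using hz)).filter_mono nhdsWithin_le_nhds
  filter_upwards [(Filter.eventually_all_finset J).2 h] with t ht
  exact Finset.prod_ne_zero_iff.2 ht

theorem hasFDerivAt_coordinate_prod {d : ℕ} (J : Finset (Fin d)) (z : Fin d → ℂ) :
    HasFDerivAt (fun y : Fin d → ℂ => ∏ i ∈ J, y i)
      (∑ i ∈ J, (∏ j ∈ J.erase i, z j) •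
        (ContinuousLinearMap.proj i : (Fin d → ℂ) →L[ℂ] ℂ)) z :=
  HasFDerivAt.finsetProd fun i _ => 
    (ContinuousLinearMap.proj (R := ℂ) (φ := fun _ : Fin d => ℂ) i).hasFDerivAt

theorem tendsto_chart_symm {H X : Type*} [TopologicalSpace H] [TopologicalSpace X]
    {e : OpenPartialHomeomorph X H} {x : X} (hx : x ∈ e.source) :
    Tendsto e.symm (𝓝 (e x)) (𝓝 x) := by
  have hc : ContinuousAt e.symm (e x) := e.continuousAt_symm (e.map_source hx)
  rwa [ContinuousAt, e.left_inv hx] at hc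

variable {d p : ℕ} {X : Type u} [TopologicalSpace X] [ChartedSpace (Fin d → ℂ) X]

/-- At `y`, the expression of `α` in the chart `e` pulls back to zero on the coordinate
hyperplanes `xᵢ = 0`, `i ∈ J`, that pass through `y`. -/
def VanishesAlong (e : OpenPartialHomeomorph X (Fin d → ℂ)) (J : Finset (Fin d))
    (α : ∀ x : X, FormFiber d p x) (y : X) : Prop :=
  ∀ i ∈ J, e y i = 0 → ∀ v : Fin p → Fin d → ℂ, (∀ k, v k i = 0) → chartForm e α (e y) v = 0

variable {D : Set X} {e e' : OpenPartialHomeomorph X (Fin d → ℂ)} {J J' : Finset (Fin d)}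
  {α : ∀ x : X, FormFiber d p x} {x y : X}

theorem IsAdaptedChart.notMem_iff (he : IsAdaptedChart D e J) (hy : y ∈ e.source) :
    y ∉ D ↔ ∏ i ∈ J, e y i ≠ 0 := by
  rw [he.mem_iff y hy, Finset.prod_ne_zero_iff]
  push Not
  rfl

/-- A vector tangent to one of the hyperplanes of a second adapted chart is tangent to one of the
hyperplanes of the first, because the line it spans stays in `D`. -/
theorem IsAdaptedChart.exists_fderiv_transition_eq_zero (he : IsAdaptedChart D e J)
    (he' : IsAdaptedChart D e' J') (hy : y ∈ e.source) (hy' : y ∈ e'.source) {i : Fin d}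
    (hi : i ∈ J') (hyi : e' y i = 0) {u : Fin d → ℂ} (hu : u i = 0) :
    ∃ j ∈ J, e y j = 0 ∧ fderiv ℂ (fun z => e (e'.symm z)) (e' y) u j = 0 := by
  have hφ : AnalyticAt ℂ (fun z => e (e'.symm z)) (e' y) :=
    analyticAt_transition he'.holomorphic he.holomorphic (e'.map_source hy')
      (by rwa [e'.left_inv hy'])
  have hl : Tendsto (fun t : ℂ => e' y + t • u) (𝓝 0) (𝓝 (e' y)) := by
    have : Continuous fun t : ℂ => e' y + t • u := by fun_prop
    simpa using this.tendsto 0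
  have hD : ∀ᶠ t : ℂ in 𝓝 0, ∃ j ∈ J, e (e'.symm (e' y + t • u)) j = 0 := by
    filter_upwards [hl.eventually (e'.open_target.mem_nhds (e'.map_source hy')),
      hl.eventually ((tendsto_chart_symm hy').eventually (e.open_source.mem_nhds hy))] with t ht ht'
    refine (he.mem_iff _ ht').1 ((he'.mem_iff _ (e'.map_target ht)).2 ⟨i, hi, ?_⟩)
    rw [e'.right_inv ht]
    simp [hyi, hu]
  obtain ⟨j, hj, hfr⟩ : ∃ j ∈ J, ∃ᶠ t : ℂ in 𝓝[≠] 0, e (e'.symm (e' y + t • u)) j = 0 := by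
    by_contra! h
    have h' : ∀ j ∈ J, ∀ᶠ t : ℂ in 𝓝[≠] 0, ¬ e (e'.symm (e' y + t • u)) j = 0 :=
      fun j hj => h j hj
    obtain ⟨t, ht, j, hj, h0⟩ := (((Filter.eventually_all_finset J).2 h').and
      (hD.filter_mono nhdsWithin_le_nhds)).exists
    exact ht j hj h0
  have hder : HasDerivAt (fun t : ℂ => e (e'.symm (e' y + t • u)) j)
      (fderiv ℂ (fun z => e (e'.symm z)) (e' y) u j) 0 := by
    have hline : HasDerivAt (fun t : ℂ => e' y + t • u) u 0 := by
      simpa using ((hasDerivAt_id (0 : ℂ)).smul_const u).const_add (e' y)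
    have h1 : HasFDerivAt (fun z => e (e'.symm z)) (fderiv ℂ (fun z => e (e'.symm z)) (e' y))
        (e' y + (0 : ℂ) • u) := by
      simpa using hφ.differentiableAt.hasFDerivAt
    exact hasDerivAt_pi.1 (h1.comp_hasDerivAt (0 : ℂ) hline) j
  have hyj : e y j = 0 := by
    have h1 : Tendsto (fun t : ℂ => e (e'.symm (e' y + t • u)) j) (𝓝[≠] 0) (𝓝 (e y j)) := by
      have := hder.continuousAt.tendsto.mono_left (nhdsWithin_le_nhds (s := {0}ᶜ))
      simpa [e'.left_inv hy'] using this
    exact isClosed_singleton.mem_of_frequently_of_tendsto (s := {(0 : ℂ)}) hfr h1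
  refine ⟨j, hj, hyj, ?_⟩
  refine isClosed_singleton.mem_of_frequently_of_tendsto (s := {(0 : ℂ)}) (hfr.mono ?_)
    hder.tendsto_slope
  intro t ht
  simp [slope, ht, e'.left_inv hy', hyj]

/-- Vanishing along the divisor does not depend on the adapted chart: by the previous lemma, the
tangent space of a hyperplane of the second chart is covered by those of finitely many hyperplanes
of the first, hence contained in one of them. -/
theorem VanishesAlong.change_chart (h : VanishesAlong e J α y) (he : IsAdaptedChart D e J)
    (he' : IsAdaptedChart D e' J') (hy : y ∈ e.source) (hy' : y ∈ e'.source) :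
    VanishesAlong e' J' α y := by
  classical
  intro i hi hyi v hv
  set L := fderiv ℂ (fun z => e (e'.symm z)) (e' y) with hL
  let H : Submodule ℂ (Fin d → ℂ) := LinearMap.ker (LinearMap.proj i)
  let K : Fin d → Submodule ℂ H := fun j =>
    LinearMap.ker ((LinearMap.proj j).comp (L.toLinearMap.comp H.subtype))
  have hcov : ⋃ q ∈ (J.filter fun j => e y j = 0).image K, (q : Set H) = Set.univ := by
    refine Set.eq_univ_of_forall fun u => ?_
    obtain ⟨j, hj, hyj, h0⟩ :=
      he.exists_fderiv_transition_eq_zero he' hy hy' hi hyi (u := u) u.2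
    simp only [Set.mem_iUnion]
    exact ⟨K j, Finset.mem_image_of_mem _ (Finset.mem_filter.2 ⟨hj, hyj⟩), h0⟩
  have htop : ⊤ ∈ (J.filter fun j => e y j = 0).image K := by
    by_contra hne
    exact Subspace.biUnion_ne_univ_of_top_notMem hne hcov
  obtain ⟨j, hj, hjK⟩ := Finset.mem_image.1 htop
  rw [Finset.mem_filter] at hj
  have h1 := chartForm_transition he'.holomorphic he.holomorphic α (e'.map_source hy')
    (by rwa [e'.left_inv hy'])
  rw [h1, e'.left_inv hy']
  refine h j hj.1 hj.2 _ fun k => ?_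
  have : (⟨v k, hv k⟩ : H) ∈ K j := hjK ▸ Submodule.mem_top
  exact this

end Vanishing

/-! ### Minor log forms are the holomorphic forms that vanish along the divisor -/

section MinorLogVanishing

variable {d p : ℕ} {X : Type u} [TopologicalSpace X] [ChartedSpace (Fin d → ℂ) X]

/-- The form on `X` whose expression in the chart `e` is `τ`. Only its values in the domain of `e`
are meaningful. -/
noncomputable def formOfChart (e : OpenPartialHomeomorph X (Fin d → ℂ))
    (τ : (Fin d → ℂ) → (Fin d → ℂ) [⋀^Fin p]→L[ℂ] ℂ) (x : X) : FormFiber d p x :=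
  (τ (e x)).compContinuousLinearMap (mfderiv 𝓘(ℂ, Fin d → ℂ) 𝓘(ℂ, Fin d → ℂ) e x)

variable {D : Set X} {e : OpenPartialHomeomorph X (Fin d → ℂ)} {J : Finset (Fin d)}
  {α : ∀ x : X, FormFiber d p x} {x : X} {τ : (Fin d → ℂ) → (Fin d → ℂ) [⋀^Fin p]→L[ℂ] ℂ}

theorem chartForm_formOfChart (he : e ∈ IsManifold.maximalAtlas 𝓘(ℂ, Fin d → ℂ) ω X)
    {z : Fin d → ℂ} (hz : z ∈ e.target) : chartForm e (formOfChart e τ) z = τ z := by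
  have hm : e.MDifferentiable 𝓘(ℂ, Fin d → ℂ) 𝓘(ℂ, Fin d → ℂ) :=
    ⟨fun y hy => (mdiff_chart he hy).mdifferentiableWithinAt,
      fun y hy => (mdiff_chart_symm he hy).mdifferentiableWithinAt⟩
  have h : (mfderiv 𝓘(ℂ, Fin d → ℂ) 𝓘(ℂ, Fin d → ℂ) e (e.symm z) :
      (Fin d → ℂ) →L[ℂ] (Fin d → ℂ)).comp (mfderiv 𝓘(ℂ, Fin d → ℂ) 𝓘(ℂ, Fin d → ℂ) e.symm z :
      (Fin d → ℂ) →L[ℂ] (Fin d → ℂ)) = ContinuousLinearMap.id ℂ (Fin d → ℂ) :=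
    hm.comp_symm_deriv hz
  ext v
  change τ (e (e.symm z)) (fun i => ((mfderiv 𝓘(ℂ, Fin d → ℂ) 𝓘(ℂ, Fin d → ℂ) e (e.symm z) :
      (Fin d → ℂ) →L[ℂ] (Fin d → ℂ)).comp (mfderiv 𝓘(ℂ, Fin d → ℂ) 𝓘(ℂ, Fin d → ℂ) e.symm z :
      (Fin d → ℂ) →L[ℂ] (Fin d → ℂ))) (v i)) = _
  rw [h, e.right_inv hz]
  rfl

theorem chartForm_formOfChart_eventually
    (he : e ∈ IsManifold.maximalAtlas 𝓘(ℂ, Fin d → ℂ) ω X) (hx : x ∈ e.source) :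
    chartForm e (formOfChart e τ) =ᶠ[𝓝 (e x)] τ := by
  filter_upwards [e.open_target.mem_nhds (e.map_source hx)] with z hz
  exact chartForm_formOfChart he hz

variable [IsManifold 𝓘(ℂ, Fin d → ℂ) ω X]

theorem holomorphicFormAt_formOfChart (he : e ∈ IsManifold.maximalAtlas 𝓘(ℂ, Fin d → ℂ) ω X)
    (hx : x ∈ e.source) (hτ : AnalyticAt ℂ τ (e x)) : HolomorphicFormAt (formOfChart e τ) x :=
  (holomorphicFormAt_iff he hx).2 (hτ.congr (chartForm_formOfChart_eventually he hx).symm)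

/-- With `P` the product of the coordinates `xᵢ`, `i ∈ J`, a minor log form `a` satisfies
`P (da - δ) = dP ∧ a` for some holomorphic form `δ`. -/
theorem IsMinorLogFormAt.exists_wedge_eq (he : IsAdaptedChart D e J) (hx : x ∈ e.source)
    (h : IsMinorLogFormAt D α x) :
    ∃ δ : (Fin d → ℂ) → (Fin d → ℂ) [⋀^Fin (p + 1)]→L[ℂ] ℂ, AnalyticAt ℂ δ (e x) ∧
      ∀ᶠ z in 𝓝 (e x), (∏ i ∈ J, z i) • _root_.extDeriv (chartForm e α) z = (∏ i ∈ J, z i) • δ z +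
        covectorWedge (Fin d → ℂ) p (fderiv ℂ (fun y : Fin d → ℂ => ∏ i ∈ J, y i) z)
          (chartForm e α z) := by
  obtain ⟨β, ⟨hβ, -, δ, hδ, hβδ⟩, hαβ⟩ :=
    h.eq_smul (fun y => ∏ i ∈ J, e y i) ⟨e, J, hx, he, .of_forall fun _ => rfl⟩
  have hα := (holomorphicFormAt_iff he.holomorphic hx).1 h.holomorphic
  have hδ' := (holomorphicFormAt_iff he.holomorphic hx).1 hδ
  set P : (Fin d → ℂ) → ℂ := fun y => ∏ i ∈ J, y i
  have hP : ∀ z, AnalyticAt ℂ P z := fun z => Finset.analyticAt_fun_prod _ fun i _ =>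
    (ContinuousLinearMap.proj (R := ℂ) (φ := fun _ : Fin d => ℂ) i).analyticAt _
  refine ⟨chartForm e δ, hδ', ?_⟩
  -- off the divisor this is the definition of a minor log form
  have hoff : ∀ᶠ z in 𝓝 (e x), P z ≠ 0 → P z • _root_.extDeriv (chartForm e α) z =
      P z • chartForm e δ z + covectorWedge (Fin d → ℂ) p (fderiv ℂ P z) (chartForm e α z) := by
    have hs := tendsto_chart_symm hx
    filter_upwards [e.open_target.mem_nhds (e.map_source hx), hs.eventually hβ,
      hs.eventually hβδ, (hs.eventually hαβ).eventually_nhds] with z hz hβz hβδz hαβz hPz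
    have hiff : ∀ w ∈ e.target, P w ≠ 0 → e.symm w ∉ D := fun w hw hPw => by
      rw [he.notMem_iff (e.map_target hw), e.right_inv hw]
      exact hPw
    have hzs := e.map_target hz
    have hb : AnalyticAt ℂ (chartForm e β) z := by
      have := (holomorphicFormAt_iff he.holomorphic hzs).1 (hβz (hiff z hz hPz))
      rwa [e.right_inv hz] at this
    have ha : chartForm e α =ᶠ[𝓝 z] fun w => P w • chartForm e β w := by
      filter_upwards [hαβz, e.open_target.mem_nhds hz, (hP z).continuousAt.eventually_ne hPz]
        with w hw hwt hPw
      have h1 : P w • chartForm e β w =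
          chartForm e (fun y => (∏ i ∈ J, e y i) • β y) w := by
        rw [chartForm_smul (fun y => ∏ i ∈ J, e y i)]
        simp only [e.right_inv hwt, P]
      rw [h1, chartForm, chartForm, hw (hiff w hwt hPw)]
    have hdβ : P z • _root_.extDeriv (chartForm e β) z = chartForm e δ z := by
      have h1 : P z • chartForm e (manifoldExtDeriv β) z =
          chartForm e (fun y => (∏ i ∈ J, e y i) • manifoldExtDeriv β y) z := by
        rw [chartForm_smul (fun y => ∏ i ∈ J, e y i)]
        simp only [e.right_inv hz, P]
      rw [← chartForm_manifoldExtDeriv he.holomorphic hz (hβz (hiff z hz hPz)), h1, chartForm,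
        chartForm, hβδz (hiff z hz hPz)]
    rw [ha.extDeriv_eq, ha.eq_of_nhds, extDeriv_smul_eq (hP z).differentiableAt
      hb.differentiableAt, hdβ, smul_add, map_smul]
  -- it extends to the divisor by continuity
  filter_upwards [hoff.eventually_nhds, hα.eventually_analyticAt, hδ'.eventually_analyticAt]
    with z hz hαz hδz
  refine eq_of_eventually_eq_on_line (1 : Fin d → ℂ)
    (f := fun z => P z • _root_.extDeriv (chartForm e α) z)
    (g := fun z => P z • chartForm e δ z +
      covectorWedge (Fin d → ℂ) p (fderiv ℂ P z) (chartForm e α z))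
    ((hP z).continuousAt.smul (analyticAt_extDeriv hαz).continuousAt)
    (((hP z).continuousAt.smul hδz.continuousAt).add
      ((ContinuousAt.clm_apply continuousAt_const (hP z).fderiv.continuousAt).clm_apply
        hαz.continuousAt)) ?_
  have hl : Tendsto (fun t : ℂ => z + t • (1 : Fin d → ℂ)) (𝓝[≠] 0) (𝓝 z) := by
    have : Continuous fun t : ℂ => z + t • (1 : Fin d → ℂ) := by fun_prop
    simpa using (this.tendsto 0).mono_left nhdsWithin_le_nhds
  filter_upwards [hl.eventually hz, eventually_prod_add_ne_zero J z] with t ht ht'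
  exact ht (by simpa [P] using ht')

/-- A minor log form pulls back to zero on the components of the divisor. -/
theorem IsMinorLogFormAt.vanishesAlong (he : IsAdaptedChart D e J) (hx : x ∈ e.source)
    (h : IsMinorLogFormAt D α x) : VanishesAlong e J α x := by
  intro i hi hxi v hv
  obtain ⟨δ, -, hδ⟩ := h.exists_wedge_eq he hx
  have hα := (holomorphicFormAt_iff he.holomorphic hx).1 h.holomorphic
  -- at a point of the hyperplane `xᵢ = 0`, evaluate the identity on `eᵢ` and `v`
  have hG : ∀ᶠ z in 𝓝 (e x), z i = 0 → ∏ j ∈ J.erase i, z j ≠ 0 → chartForm e α z v = 0 := by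
    filter_upwards [hδ] with z hz hzi hGz
    have hd : fderiv ℂ (fun y : Fin d → ℂ => ∏ i ∈ J, y i) z =
        (∏ j ∈ J.erase i, z j) • (ContinuousLinearMap.proj i : (Fin d → ℂ) →L[ℂ] ℂ) := by
      rw [(hasFDerivAt_coordinate_prod J z).fderiv]
      refine Finset.sum_eq_single_of_mem i hi fun j hj hji => ?_
      rw [Finset.prod_eq_zero (Finset.mem_erase.2 ⟨hji.symm, hi⟩) hzi]
      exact zero_smul ℂ (ContinuousLinearMap.proj j : (Fin d → ℂ) →L[ℂ] ℂ)
    rw [Finset.prod_eq_zero hi hzi, hd] at hz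
    replace hz := (zero_add _).symm.trans ((congrArg (· + _) (zero_smul ℂ (δ z)).symm).trans
      (hz.symm.trans (zero_smul ℂ _)))
    have h1 := covectorWedge_cons
      ((∏ j ∈ J.erase i, z j) • (ContinuousLinearMap.proj i : (Fin d → ℂ) →L[ℂ] ℂ))
      (chartForm e α z) (Pi.single i 1) v (fun k => by simp [hv k])
    rw [hz] at h1
    simpa [hGz] using h1.symm
  -- the other points of the hyperplane follow by continuity
  set w : Fin d → ℂ := Function.update 1 i 0
  have hl : Tendsto (fun t : ℂ => e x + t • w) (𝓝[≠] 0) (𝓝 (e x)) := by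
    have : Continuous fun t : ℂ => e x + t • w := by fun_prop
    simpa using (this.tendsto 0).mono_left nhdsWithin_le_nhds
  refine eq_of_eventually_eq_on_line w (f := fun z => chartForm e α z v) (g := fun _ => 0)
    (analyticAt_form_iff.1 hα v).continuousAt continuousAt_const ?_
  filter_upwards [hl.eventually hG, eventually_prod_add_ne_zero (J.erase i) (e x)] with t ht ht'
  refine ht (by simp [w, hxi]) ?_
  rw [Finset.prod_congr rfl fun j hj => ?_]
  · exact ht'
  · simp [w, Finset.ne_of_mem_erase hj]

/-- If `a` pulls back to zero on the hyperplane `xᵢ = 0`, then `dxᵢ ∧ a` is divisible by `xᵢ`. -/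
theorem exists_covectorWedge_proj_eq_smul {c : Fin d → ℂ} (i : Fin d) (hτ : AnalyticAt ℂ τ c)
    (h : ∀ᶠ z in 𝓝 c, z i = 0 → ∀ v : Fin p → Fin d → ℂ, (∀ k, v k i = 0) → τ z v = 0) :
    ∃ b : (Fin d → ℂ) → (Fin d → ℂ) [⋀^Fin (p + 1)]→L[ℂ] ℂ, AnalyticAt ℂ b c ∧ ∀ᶠ z in 𝓝 c,
      covectorWedge (Fin d → ℂ) p (ContinuousLinearMap.proj i) (τ z) = z i • b z := by
  have hw : AnalyticAt ℂ (fun z => covectorWedge (Fin d → ℂ) p (ContinuousLinearMap.proj i) (τ z))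
      c := ((covectorWedge (Fin d → ℂ) p (ContinuousLinearMap.proj i)).analyticAt _).comp hτ
  by_cases hc : c i = 0
  · refine hw.exists_eq_smul_of_eq_zero_on_hyperplane (l := ContinuousLinearMap.proj i)
      (e := Pi.single i 1) (by simp) hc ?_
    filter_upwards [h] with z hz hzi
    exact covectorWedge_proj_eq_zero i (hz hzi)
  · have hi : AnalyticAt ℂ (fun z : Fin d → ℂ => z i) c :=
      (ContinuousLinearMap.proj (R := ℂ) (φ := fun _ : Fin d => ℂ) i).analyticAt _
    refine ⟨_, (hi.inv hc).smul hw, ?_⟩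
    filter_upwards [hi.continuousAt.eventually_ne hc] with z hz
    simp [smul_smul, mul_inv_cancel₀ hz]

/-- A holomorphic form that pulls back to zero on the components of the divisor is a minor log
form: with `β = F⁻¹ α` one has `F dβ = dα - ∑ xᵢ⁻¹ dxᵢ ∧ α`, which is holomorphic. -/
theorem HolomorphicFormAt.isMinorLogFormAt (hα : HolomorphicFormAt α x) (he : IsAdaptedChart D e J)
    (hx : x ∈ e.source) (hv : ∀ᶠ y in 𝓝 x, VanishesAlong e J α y) : IsMinorLogFormAt D α x := by
  refine ⟨hα, fun F hF => ?_⟩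
  obtain ⟨e₁, he₁, hx₁, hFe₁⟩ := hF.exists_chart
  obtain ⟨e', J', hx', he', hFe'⟩ := hF
  have ha := (holomorphicFormAt_iff he'.holomorphic hx').1 hα
  have hs := tendsto_chart_symm hx'
  have ht := e'.open_target.mem_nhds (e'.map_source hx')
  have hv' : ∀ᶠ y in 𝓝 x, VanishesAlong e' J' α y := by
    filter_upwards [hv, e.open_source.mem_nhds hx, e'.open_source.mem_nhds hx'] with y hy hye hye'
    exact hy.change_chart he he' hye hye'
  -- `b i` is the quotient of `dxᵢ ∧ α` by `xᵢ`
  have hdiv : ∀ i : J', ∃ b : (Fin d → ℂ) → (Fin d → ℂ) [⋀^Fin (p + 1)]→L[ℂ] ℂ,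
      AnalyticAt ℂ b (e' x) ∧ ∀ᶠ z in 𝓝 (e' x), covectorWedge (Fin d → ℂ) p
        (ContinuousLinearMap.proj (i : Fin d)) (chartForm e' α z) = z i • b z := by
    intro i
    refine exists_covectorWedge_proj_eq_smul (i : Fin d) ha ?_
    filter_upwards [hs.eventually hv', ht] with z hz hzt hzi v hvi
    have := hz i i.2 (by rwa [e'.right_inv hzt]) v hvi
    rwa [e'.right_inv hzt] at this
  choose b hb hbw using hdiv
  set P : (Fin d → ℂ) → ℂ := fun y => ∏ i ∈ J', y i
  have hP : ∀ z, AnalyticAt ℂ P z := fun z => Finset.analyticAt_fun_prod _ fun i _ =>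
    (ContinuousLinearMap.proj (R := ℂ) (φ := fun _ : Fin d => ℂ) i).analyticAt _
  have hδ : AnalyticAt ℂ (fun z => _root_.extDeriv (chartForm e' α) z - ∑ i, b i z) (e' x) :=
    (analyticAt_extDeriv ha).sub (Finset.analyticAt_fun_sum _ fun i _ => hb i)
  have hinv : ∀ᶠ y in 𝓝 x, y ∉ D → HolomorphicFormAt (fun y => (F y)⁻¹ • α y) y := by
    filter_upwards [hFe₁, hα.eventually] with y hy hαy hyD
    refine HolomorphicFormAt.fun_smul (F := fun y => (F y)⁻¹) he₁ hy.1 (hy.2.1.inv ?_) hαy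
    rw [e₁.left_inv hy.1]
    exact hy.2.2 hyD
  refine ⟨fun y => (F y)⁻¹ • α y, ⟨hinv, ⟨α, hα, ?_⟩,
    ⟨_, holomorphicFormAt_formOfChart he'.holomorphic hx' hδ, ?_⟩⟩, ?_⟩
  · filter_upwards [hFe₁] with y hy hyD
    rw [smul_smul, mul_inv_cancel₀ (hy.2.2 hyD), one_smul]
  · filter_upwards [hFe'.eventually_nhds, hinv, e'.open_source.mem_nhds hx',
      (e'.continuousAt hx').eventually (eventually_all.2 hbw),
      (e'.continuousAt hx').eventually ha.eventually_analyticAt] with y hFy hiy hys hby hay hyD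
    refine chartForm_injective (e := e') (α := fun y => F y • manifoldExtDeriv _ y)
      he'.holomorphic hys ?_
    have hyt := e'.map_source hys
    have hPy : P (e' y) ≠ 0 := (he'.notMem_iff hys).1 hyD
    have hF0 : F y = P (e' y) := hFy.self_of_nhds
    have hβ : chartForm e' (fun y => (F y)⁻¹ • α y) =ᶠ[𝓝 (e' y)]
        fun z => (P z)⁻¹ • chartForm e' α z := by
      rw [chartForm_smul fun y => (F y)⁻¹]
      filter_upwards [(tendsto_chart_symm hys).eventually hFy, e'.open_target.mem_nhds hyt]
        with z hz hzt
      rw [hz, e'.right_inv hzt]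
    have hdP : HasFDerivAt (fun z => (P z)⁻¹) (-((P (e' y)) ^ 2)⁻¹ • ∑ i ∈ J',
        (∏ j ∈ J'.erase i, e' y j) • (ContinuousLinearMap.proj i : (Fin d → ℂ) →L[ℂ] ℂ)) (e' y) :=
      (hasDerivAt_inv hPy).comp_hasFDerivAt (e' y) (hasFDerivAt_coordinate_prod J' (e' y))
    rw [chartForm_smul, chartForm_formOfChart he'.holomorphic hyt]
    beta_reduce
    rw [chartForm_manifoldExtDeriv he'.holomorphic hyt (by rw [e'.left_inv hys]; exact hiy hyD),
      e'.left_inv hys, hF0, hβ.extDeriv_eq, extDeriv_smul_eq hdP.differentiableAt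
      hay.differentiableAt, hdP.fderiv, smul_add, smul_smul, mul_inv_cancel₀ hPy, one_smul,
      sub_eq_add_neg]
    congr 1
    rw [map_smul, map_sum, smul_apply, sum_apply, smul_smul, Finset.smul_sum,
      ← Finset.sum_coe_sort J', ← Finset.sum_neg_distrib]
    refine Finset.sum_congr rfl fun i _ => ?_
    have hPi : P (e' y) = e' y i * ∏ j ∈ J'.erase (i : Fin d), e' y j :=
      (Finset.mul_prod_erase J' _ i.2).symm
    rw [map_smul, smul_apply, hby i, smul_smul, smul_smul, ← neg_one_smul ℂ (b i (e' y))]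
    congr 1
    rw [mul_assoc, mul_comm (∏ j ∈ J'.erase (i : Fin d), e' y j), ← hPi]
    field_simp
  · filter_upwards [hFe₁] with y hy hyD
    rw [smul_smul, mul_inv_cancel₀ (hy.2.2 hyD), one_smul]

end MinorLogVanishing

/-! ### Local exactness of the augmented minor log complex -/

/-- A linear map that kills `f` along a segment kills the average of `f` along it. -/
theorem eventually_map_segmentAverage_eq_zero {E F G : Type*} [NormedAddCommGroup E]
    [NormedSpace ℂ E] [NormedAddCommGroup F] [NormedSpace ℂ F] [CompleteSpace F]
    [NormedAddCommGroup G] [NormedSpace ℂ G] [CompleteSpace G] {f : E → F} {c : E}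
    (hf : AnalyticAt ℂ f c) (A : E →L[ℂ] E) (k : ℕ) :
    ∀ᶠ y in 𝓝 c, ∀ L : F →L[ℂ] G,
      (∀ t ∈ Set.Icc (0 : ℝ) 2, L (f (c + (y - c + ((t : ℂ) - 1) • A (y - c)))) = 0) →
      L (segmentAverage A k f c y) = 0 := by
  filter_upwards [eventually_segment A hf.eventually_analyticAt] with y hy L hL
  have hmem : ∀ t ∈ Set.uIcc (0 : ℝ) 1, t ∈ Set.Icc (0 : ℝ) 2 := fun t ht => by
    rw [Set.uIcc_of_le zero_le_one] at ht
    exact ⟨ht.1, ht.2.trans one_le_two⟩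
  have hint : IntervalIntegrable (fun t : ℝ =>
      (t : ℂ) ^ k • f (c + (y - c + ((t : ℂ) - 1) • A (y - c)))) MeasureTheory.volume 0 1 := by
    refine ContinuousOn.intervalIntegrable fun t ht => ?_
    have h1 : ContinuousAt f (c + (y - c + ((t : ℂ) - 1) • A (y - c))) :=
      (hy t (hmem t ht)).continuousAt
    have h2 : ContinuousAt (fun t : ℝ => c + (y - c + ((t : ℂ) - 1) • A (y - c))) t := by fun_prop
    exact (ContinuousAt.smul (by fun_prop) (ContinuousAt.comp
      (f := fun t : ℝ => c + (y - c + ((t : ℂ) - 1) • A (y - c))) h1 h2)).continuousWithinAt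
  rw [segmentAverage, ← L.intervalIntegral_comp_comm hint,
    intervalIntegral.integral_congr (g := fun _ => (0 : G)) fun t ht => ?_]
  · simp
  · simp only [map_smul, hL t (hmem t ht), smul_zero]

section LocalExactness

variable {d p : ℕ} {X : Type u} [TopologicalSpace X] [ChartedSpace (Fin d → ℂ) X]
  [IsManifold 𝓘(ℂ, Fin d → ℂ) ω X] {D : Set X} {x : X}

/-- A closed minor log form of positive degree is locally the exterior derivative of a minor log
form: the radial vector field with centre `x` is tangent to the coordinate hyperplanes through `x`,
so the radial primitive inherits the vanishing along the divisor. -/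
theorem exists_minorLog_primitive (hD : IsNormalCrossingDivisor d D)
    {α : ∀ x : X, FormFiber d (p + 1) x} (hα : ∀ᶠ y in 𝓝 x, IsMinorLogFormAt D α y)
    (hdα : ∀ᶠ y in 𝓝 x, manifoldExtDeriv α y = 0) :
    ∃ β : ∀ x : X, FormFiber d p x, (∀ᶠ y in 𝓝 x, IsMinorLogFormAt D β y) ∧
      ∀ᶠ y in 𝓝 x, manifoldExtDeriv β y = α y := by
  obtain ⟨e, J, hx, he⟩ := hD x
  have hol : HolomorphicFormAt α x := hα.self_of_nhds.holomorphic
  have ha : AnalyticAt ℂ (chartForm e α) (e x) := (holomorphicFormAt_iff he.holomorphic hx).1 hol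
  have hs := tendsto_chart_symm hx
  have ht := e.open_target.mem_nhds (e.map_source hx)
  have hda : ∀ᶠ z in 𝓝 (e x), extDeriv (chartForm e α) z = 0 := by
    filter_upwards [chartForm_manifoldExtDeriv_eventually he.holomorphic hx hol,
      hs.eventually hdα] with z hz hz0
    rw [← hz, chartForm, hz0]
    rfl
  obtain ⟨hb, hdb⟩ := extDeriv_radial_primitive ha hda
  set b : (Fin d → ℂ) → (Fin d → ℂ) [⋀^Fin p]→L[ℂ] ℂ := fun z =>
    (segmentAverage (.id ℂ (Fin d → ℂ)) p (chartForm e α) (e x) z).curryLeft (z - e x)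
  have hβ : HolomorphicFormAt (formOfChart e b : ∀ x : X, FormFiber d p x) x :=
    holomorphicFormAt_formOfChart he.holomorphic hx hb
  have hva : ∀ᶠ z in 𝓝 (e x), VanishesAlong e J α (e.symm z) ∧ z ∈ e.target := by
    filter_upwards [hs.eventually hα, ht] with z hz hzt
    exact ⟨hz.vanishesAlong he (e.map_target hzt), hzt⟩
  -- the hyperplanes that do not pass through the centre stay away from it
  have hJ : ∀ᶠ z in 𝓝 (e x), ∀ i ∈ J, z i = 0 → e x i = 0 := by
    refine (Filter.eventually_all_finset J).2 fun i _ => ?_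
    by_cases hi : e x i = 0
    · exact .of_forall fun _ _ => hi
    · filter_upwards [(continuous_apply i).continuousAt.eventually_ne hi] with z hz h0
      exact absurd h0 hz
  have hvb : ∀ᶠ z in 𝓝 (e x), ∀ i ∈ J, z i = 0 → ∀ v : Fin p → Fin d → ℂ,
      (∀ k, v k i = 0) → b z v = 0 := by
    filter_upwards [hJ, eventually_segment (.id ℂ (Fin d → ℂ)) hva,
      eventually_map_segmentAverage_eq_zero (G := ℂ) ha (.id ℂ (Fin d → ℂ)) p]
      with z hzJ hzv hz i hi hzi v hv
    refine hz (ContinuousAlternatingMap.apply ℂ (Fin d → ℂ) ℂ (Matrix.vecCons (z - e x) v))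
      fun t htI => ?_
    obtain ⟨h1, h2⟩ := hzv t htI
    have hxi := hzJ i hi hzi
    have h3 := h1 i hi (by rw [e.right_inv h2]; simp [hxi, hzi])
      (Matrix.vecCons (z - e x) v) fun k => by
      refine Fin.cases ?_ (fun k => ?_) k
      · simp [hxi, hzi]
      · simpa using hv k
    rwa [e.right_inv h2] at h3
  have hvβ : ∀ᶠ y in 𝓝 x, VanishesAlong e J (formOfChart e b : ∀ x : X, FormFiber d p x) y := by
    filter_upwards [(e.continuousAt hx).eventually hvb, e.open_source.mem_nhds hx] with y hy hys
    intro i hi hyi v hv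
    rw [chartForm_formOfChart he.holomorphic (e.map_source hys)]
    exact hy i hi hyi v hv
  refine ⟨formOfChart e b, ?_, ?_⟩
  · filter_upwards [hβ.eventually, hvβ.eventually_nhds, e.open_source.mem_nhds hx]
      with y hy hyv hys
    exact hy.isMinorLogFormAt he hys hyv
  · filter_upwards [(e.continuousAt hx).eventually hdb, hβ.eventually, e.open_source.mem_nhds hx]
      with y hy hyβ hys
    refine chartForm_injective he.holomorphic hys ?_
    have hyt := e.map_source hys
    rw [chartForm_manifoldExtDeriv he.holomorphic hyt (by rwa [e.left_inv hys]),
      (chartForm_formOfChart_eventually he.holomorphic hys).extDeriv_eq, hy]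

/-- A closed minor log form of degree `0` is a section of `ℂ_{U!}`: it is locally constant, and it
vanishes at the points of the divisor. -/
theorem exists_constExtByZero_of_closed (hD : IsNormalCrossingDivisor d D)
    {α : ∀ x : X, FormFiber d 0 x} (hα : ∀ᶠ y in 𝓝 x, IsMinorLogFormAt D α y)
    (hdα : ∀ᶠ y in 𝓝 x, manifoldExtDeriv α y = 0) :
    ∃ s : X → ℂ, (∀ᶠ y in 𝓝 x, s ∈ (constExtByZeroCondition D).holds y) ∧
      ∀ᶠ y in 𝓝 x, functionAsForm d s y = α y := by
  obtain ⟨e, J, hx, he⟩ := hD x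
  have hol : HolomorphicFormAt α x := hα.self_of_nhds.holomorphic
  have ha : AnalyticAt ℂ (chartForm e α) (e x) := (holomorphicFormAt_iff he.holomorphic hx).1 hol
  have hs := tendsto_chart_symm hx
  let s : X → ℂ := fun y => α y Fin.elim0
  have hsa : ∀ z v, chartForm e α z v = s (e.symm z) := fun z v =>
    congrArg (α (e.symm z)) (Subsingleton.elim _ _)
  have hca : chartForm e α = fun z =>
      ContinuousAlternatingMap.constOfIsEmpty ℂ (Fin d → ℂ) (Fin 0) (s (e.symm z)) := by
    funext z
    ext v
    exact hsa z v
  have hd : ∀ᶠ z in 𝓝 (e x), DifferentiableAt ℂ (fun z => s (e.symm z)) z ∧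
      fderiv ℂ (fun z => s (e.symm z)) z = 0 := by
    filter_upwards [chartForm_manifoldExtDeriv_eventually he.holomorphic hx hol,
      hs.eventually hdα, ha.eventually_analyticAt] with z hz hz0 haz
    constructor
    · have := (analyticAt_form_iff.1 haz Fin.elim0).differentiableAt
      simpa only [hsa] using this
    · rw [chartForm, hz0, hca, extDeriv_constOfIsEmpty] at hz
      ext u
      exact (congrArg (fun T : (Fin d → ℂ) [⋀^Fin 1]→L[ℂ] ℂ => T fun _ => u) hz).symm
  have hconst : ∀ᶠ z in 𝓝 (e x), s (e.symm z) = s x := by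
    obtain ⟨r, hr, hrd⟩ := Metric.eventually_nhds_iff_ball.1 hd
    filter_upwards [Metric.ball_mem_nhds (e x) hr] with z hz
    have := Metric.isOpen_ball.is_const_of_fderiv_eq_zero (𝕜 := ℂ)
      (convex_ball (e x) r).isPreconnected (fun w hw => (hrd w hw).1.differentiableWithinAt)
      (fun w hw => (hrd w hw).2) hz (Metric.mem_ball_self hr)
    rwa [e.left_inv hx] at this
  have hsx : ∀ᶠ y in 𝓝 x, s y = s x := by
    filter_upwards [(e.continuousAt hx).eventually hconst, e.open_source.mem_nhds hx] with y hy hys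
    rwa [e.left_inv hys] at hy
  refine ⟨s, ?_, .of_forall fun y => ?_⟩
  · filter_upwards [hsx.eventually_nhds, hα, e.open_source.mem_nhds hx] with y hy hαy hys
    refine ⟨fun _ => hy.mono fun z hz => hz.trans hy.self_of_nhds.symm, fun hyD => ?_⟩
    obtain ⟨i, hi, hyi⟩ := (he.mem_iff y hys).1 hyD
    have h0 := hαy.vanishesAlong he hys i hi hyi Fin.elim0 fun k => k.elim0
    rw [hsa, e.left_inv hys] at h0
    exact hy.mono fun z hz => hz.trans (hy.self_of_nhds.symm.trans h0)
  · ext v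
    exact congrArg (α y) (Subsingleton.elim _ _)

end LocalExactness

theorem mainTheorem9 {d : ℕ} {X : Type u} [TopologicalSpace X] [ChartedSpace (Fin d → ℂ) X]
    [IsManifold 𝓘(ℂ, Fin d → ℂ) ω X] (D : Set X) (hD : IsNormalCrossingDivisor d D) :
    QuasiIso (minorLogAugmentation d D) := by
  refine quasiIso_minorLogAugmentation (fun w => ?_) (fun p w => ?_) ?_
  · exact GermCondition.LocalOperator.exact_of_germs _ _ w fun α x hα hdα =>
      exists_constExtByZero_of_closed hD hα hdα
  · exact GermCondition.LocalOperator.exact_of_germs _ _ w fun α x hα hdα =>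
      exists_minorLog_primitive hD hα hdα
  · exact GermCondition.LocalOperator.mono_hom_of_injective _ fun s x hs =>
      congrArg (fun T : FormFiber d 0 x => T Fin.elim0) hs
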